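/- All graphs are simple; a labelling of a graph $G$ is a function $\sigma\colon E(G)\to\mathbb Z_2$. It is anti-even-balancing if for every induced cycle $C$ of $G$ the sum of the labels of the edges of $C$ is $0$ if $C$ is a triangle and $1$ if $C$ has at least four vertices. Let $\mathbb C_3$ be the graph whose vertices are the unit complex numbers with rational argument (in radians, $\arg$ having range $(-\pi,\pi]$), where $z,w$ are adjacent if and only if $|\arg(z/w)|>\frac23\pi$, and let $\overline{\mathbb C_3}$ be its complement. Theorem. The vertex set of $\mathbb C_3$ can be partitioned into two dense subsets $C_0,C_1$ (dense in the topology inherited from the unit circle), and $\overline{\mathbb C_3}$ has an induced $5$-cycle $p^0p^1p^2p^3p^4$. Let any such $C_0,C_1$ and $p^0,\dots,p^4$ be given. For a vertex $x$ let $i(x)\in\{0,1\}$ be the index with $x\in C_{i(x)}$, and let $p_x=p^k$ for the smallest $k\in\{0,\dots,4\}$ such that $xp^k$ is an edge of $\overline{\mathbb C_3}$. Then the edges $xp_x$ form a spanning tree of $\overline{\mathbb C_3}$, and there is a unique anti-even-balancing labelling $\sigma$ of $\overline{\mathbb C_3}$ with $\sigma(xp_x)=i(x)$ for every vertex $x\neq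 p^0$. Moreover, for every finite graph $G$ with no independent set of size $3$ and every anti-even-balancing labelling $\sigma_G$ of $G$, there is an embedding $f$ of $G$ into $\overline{\mathbb C_3}$ as an induced subgraph such that $\sigma(f(x)f(y))=\sigma_G(xy)$ for every edge $xy$ of $G$. -/

import Mathlib

open SimpleGraph

noncomputable section

/-- Unit complex numbers whose argument in `(-π, π]` (in radians) is a rational number.
As a subtype of the unit circle it carries the subspace topology. -/
abbrev CircVertex : Type := {z : Circle // ∃ q : ℚ, Complex.arg (z : ℂ) = (q : ℝ)}

/-- The generic circular triangle-free graph `ℂ₃`: `z` and `w` are adjacent if and only if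
`|arg (z / w)| > 2π/3`. -/
def circC3 : SimpleGraph CircVertex where
  Adj z w := 2 / 3 * Real.pi < |Complex.arg ((z.1 : ℂ) / (w.1 : ℂ))|
  symm := ⟨fun z w h => by
    have e : ((w.1 : ℂ) / (z.1 : ℂ)) = ((z.1 : ℂ) / (w.1 : ℂ))⁻¹ := by rw [inv_div]
    rw [e, Complex.abs_arg_inv]
    exact h⟩
  loopless := ⟨fun z h => by
    rw [div_self (Circle.coe_ne_zero z.1), Complex.arg_one, abs_zero] at h
    linarith [Real.pi_pos]⟩

/-- The complement of `ℂ₃`. -/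
abbrev coC3 : SimpleGraph CircVertex := circC3ᶜ

/-- A `ℤ/2`-labelling of the edges of a graph. -/
abbrev Labelling {V : Type*} (G : SimpleGraph V) : Type _ := G.edgeSet → ZMod 2

namespace Labelling

variable {V W : Type*} {G : SimpleGraph V} {H : SimpleGraph W}

/-- The labelling of `H` induced by a labelling of `G` along an embedding of `H` into `G` as an
induced subgraph. -/
def pullback (σ : Labelling G) (f : H ↪g G) : Labelling H := fun e => σ (f.mapEdgeSet e)

/-- A labelling is anti-even-balancing if the labels on the edges of every induced cycle sum to
`0` if the cycle is a triangle and to `1` if it is longer. An induced cycle with `n ≥ 3` vertices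
is the image of an embedding of the standard `n`-cycle as an induced subgraph. -/
def IsAntiEvenBalancing (σ : Labelling G) : Prop :=
  ∀ n : ℕ, 3 ≤ n → ∀ f : cycleGraph n ↪g G,
    ∑ᶠ e : (cycleGraph n).edgeSet, σ.pullback f e = if n = 3 then 0 else 1

end Labelling

/-- `i` is the index function of a partition of the vertices into two dense classes `C₀, C₁`,
that is, `x` lies in the class with index `i x`. -/
def IsDensePartition (i : CircVertex → ZMod 2) : Prop :=
  Dense {x | i x = 0} ∧ Dense {x | i x = 1}

/-- For an induced 5-cycle `p⁰, …, p⁴` of the complement of `ℂ₃`, the vertex `pᵏ` is the vertex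
`p_x`: `k` is the smallest index such that `x pᵏ` is an edge. -/
def IsFirstNeighbour (p : cycleGraph 5 ↪g coC3) (x : CircVertex) (k : Fin 5) : Prop :=
  coC3.Adj x (p k) ∧ ∀ j < k, ¬ coC3.Adj x (p j)

/-- The graph on all vertices whose edges are the pairs `x p_x`. -/
def firstNeighbourTree (p : cycleGraph 5 ↪g coC3) : SimpleGraph CircVertex :=
  SimpleGraph.fromRel fun x y => ∃ k, IsFirstNeighbour p x k ∧ y = p k

/-- The labelling `σ` has the prescribed values on the tree: `σ (x p_x) = i x` for every
`x ≠ p⁰`. Each edge of the tree is `x p_x` for exactly one `x ≠ p⁰` (note that `p⁰` and `p¹`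
give the same edge). -/
def HasTreeLabels (i : CircVertex → ZMod 2) (p : cycleGraph 5 ↪g coC3) (σ : Labelling coC3) :
    Prop :=
  ∀ (x : CircVertex) (k : Fin 5) (h : IsFirstNeighbour p x k), x ≠ p 0 →
    σ ⟨s(x, p k), h.1⟩ = i x

end

noncomputable section

/-! Switching a labelling by `s`, that is, adding `s x + s y` to every edge `xy`, changes no cycle
sum. Without independent triples an induced cycle has at most five vertices, so being
anti-even-balancing amounts to `HasCycleSums` with `ε = 1`. The sum of two such labellings has `ε =
0`, and `exists_coboundary` makes it a switching of zero.

Uniqueness: if two anti-even-balancing labellings agree on the tree, the potential of their sum is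
constant along the tree, so the labellings are equal.

Existence: scale the circle to length three and cut it at `-1`. Vertices of the complement are then
adjacent exactly when their circular distance is less than 1. Label an edge by the parity `wrap` of
the crossings of its short arc with the cut. An induced cycle of length four or five winds once
around the circle and a triangle does not, so `wrap` is anti-even-balancing (`hasCycleSums_wrap`).
Switching it by `treePotential` gives the prescribed tree labels. This potential is `i` plus a
function that is constant between finitely many positions, apart from its value at the root. Density
of the classes therefore puts both of its values into every arc.

Embedding: an anti-even-balancing `G` without independent triples splits into three cliques such
that, after a switching `s`, exactly the edges between classes 0 and 2 have label 1
(`exists_isCliquePartition`). Place class `j` in the arc from `j - 3/2` to `j - 1/2`. For vertices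
of two cyclically consecutive classes, adjacency says which of the two has the smaller offset in its
arc. These demands are acyclic (`exists_numbering`), so offsets can be chosen to realise `G`. The
edges between classes 0 and 2 are then the ones crossing the cut. Each vertex can also be chosen
with potential `s`, which makes the labels agree. -/

theorem two_eq_zero_zmod_two : (2 : ZMod 2) = 0 := rfl

theorem zmod_two_eq_zero_or_one (u : ZMod 2) : u = 0 ∨ u = 1 := by
  revert u; decide

/-- `G` has no independent set of size three. -/
def NoIndepTriple {V : Type*} (G : SimpleGraph V) : Prop :=
  ∀ x y z, x ≠ y → y ≠ z → z ≠ x → G.Adj x y ∨ G.Adj y z ∨ G.Adj z x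

/-- The symmetric function `l` sums to zero on every triangle, and to `ε` on every induced cycle
of length four or five. -/
structure HasCycleSums {V : Type*} (G : SimpleGraph V) (l : V → V → ZMod 2) (ε : ZMod 2) :
    Prop where
  symm : ∀ x y, l x y = l y x
  tri : ∀ {x y z}, G.Adj x y → G.Adj y z → G.Adj z x → l x y + l y z + l z x = 0
  quad : ∀ {x y z w}, G.Adj x y → G.Adj y z → G.Adj z w → G.Adj w x → x ≠ z → y ≠ w →
    ¬ G.Adj x z → ¬ G.Adj y w → l x y + l y z + l z w + l w x = ε
  pent : ∀ {a b c d e}, G.Adj a b → G.Adj b c → G.Adj c d → G.Adj d e → G.Adj e a →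
    ¬ G.Adj a c → ¬ G.Adj b d → ¬ G.Adj c e → ¬ G.Adj d a → ¬ G.Adj e b →
    l a b + l b c + l c d + l d e + l e a = ε

theorem NoIndepTriple.adj_of_not_adj {V : Type*} {G : SimpleGraph V} (hG : NoIndepTriple G)
    {v m m' : V} (hm : m ≠ v) (hm' : m' ≠ v) (hvm : ¬ G.Adj v m) (hvm' : ¬ G.Adj v m')
    (hne : m ≠ m') : G.Adj m m' := by
  have := hG v m m' hm.symm hne hm'
  grind [SimpleGraph.adj_comm]

/-! ### Cycle sums, switching and normal forms at a vertex -/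

namespace HasCycleSums

variable {V : Type*} {G : SimpleGraph V} {l : V → V → ZMod 2} {ε : ZMod 2}

theorem switch (h : HasCycleSums G l ε) (s : V → ZMod 2) :
    HasCycleSums G (fun x y => l x y + s x + s y) ε where
  symm x y := by rw [h.symm x y]; ring
  tri {x y z} h1 h2 h3 := by
    have := h.tri h1 h2 h3
    linear_combination this + (s x + s y + s z) * two_eq_zero_zmod_two
  quad {x y z w} h1 h2 h3 h4 h5 h6 h7 h8 := by
    have := h.quad h1 h2 h3 h4 h5 h6 h7 h8
    linear_combination this + (s x + s y + s z + s w) * two_eq_zero_zmod_two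
  pent {a b c d e} h1 h2 h3 h4 h5 g1 g2 g3 g4 g5 := by
    have := h.pent h1 h2 h3 h4 h5 g1 g2 g3 g4 g5
    linear_combination this + (s a + s b + s c + s d + s e) * two_eq_zero_zmod_two

theorem congr (h : HasCycleSums G l ε) {l' : V → V → ZMod 2} (hl : ∀ x y, l' x y = l' y x)
    (he : ∀ {x y}, G.Adj x y → l' x y = l x y) : HasCycleSums G l' ε where
  symm := hl
  tri h1 h2 h3 := by
    rw [he h1, he h2, he h3]
    exact h.tri h1 h2 h3
  quad h1 h2 h3 h4 h5 h6 h7 h8 := by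
    rw [he h1, he h2, he h3, he h4]
    exact h.quad h1 h2 h3 h4 h5 h6 h7 h8
  pent h1 h2 h3 h4 h5 g1 g2 g3 g4 g5 := by
    rw [he h1, he h2, he h3, he h4, he h5]
    exact h.pent h1 h2 h3 h4 h5 g1 g2 g3 g4 g5

theorem add {l' : V → V → ZMod 2} {ε' : ZMod 2} (h : HasCycleSums G l ε)
    (h' : HasCycleSums G l' ε') : HasCycleSums G (fun x y => l x y + l' x y) (ε + ε') where
  symm x y := by rw [h.symm, h'.symm]
  tri h1 h2 h3 := by linear_combination h.tri h1 h2 h3 + h'.tri h1 h2 h3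
  quad h1 h2 h3 h4 h5 h6 h7 h8 := by
    linear_combination h.quad h1 h2 h3 h4 h5 h6 h7 h8 + h'.quad h1 h2 h3 h4 h5 h6 h7 h8
  pent h1 h2 h3 h4 h5 g1 g2 g3 g4 g5 := by
    linear_combination h.pent h1 h2 h3 h4 h5 g1 g2 g3 g4 g5 +
      h'.pent h1 h2 h3 h4 h5 g1 g2 g3 g4 g5

/-- `l` vanishes on the edges inside the closed neighbourhood of `v` and on the edges outside. -/
structure IsNormal (G : SimpleGraph V) (l : V → V → ZMod 2) (v : V) : Prop where
  star : ∀ {x}, G.Adj v x → l v x = 0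
  inner : ∀ {x y}, G.Adj v x → G.Adj v y → G.Adj x y → l x y = 0
  outer : ∀ {x y}, x ≠ v → y ≠ v → ¬ G.Adj v x → ¬ G.Adj v y → G.Adj x y → l x y = 0

/-- Switching by `l v x` at the neighbours `x` of `v` clears the star of `v`, and then triangles
through `v` clear the edges among these neighbours. The non-neighbours of `v` form a clique, which
is cleared in the same way from one of its vertices `m`. The two switchings do not interfere. -/
theorem exists_isNormal (h : HasCycleSums G l ε) (hG : NoIndepTriple G) (v : V) :
    ∃ s : V → ZMod 2, IsNormal G (fun x y => l x y + s x + s y) v := by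
  classical
  obtain ⟨r, hr⟩ : ∃ r : V → ZMod 2, ∀ {x y}, x ≠ v → y ≠ v → ¬ G.Adj v x → ¬ G.Adj v y →
      G.Adj x y → l x y + r x + r y = 0 := by
    by_cases hm : ∃ m, m ≠ v ∧ ¬ G.Adj v m
    · obtain ⟨m, hmv, hm⟩ := hm
      refine ⟨fun x => if x = m then 0 else l m x, ?_⟩
      intro x y hx hy hx' hy' hxy
      have hadj : ∀ x, x ≠ v → ¬ G.Adj v x → x ≠ m → G.Adj m x := by
        intro x h1 h2 h3
        have := hG v m x hmv.symm h3.symm h1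
        rcases this with h | h | h
        · exact absurd h hm
        · exact h
        · exact absurd h.symm h2
      have t := two_eq_zero_zmod_two
      by_cases h1 : x = m
      · subst h1
        have h2 : y ≠ x := hxy.ne'
        simp only [if_true, if_neg h2]
        linear_combination l x y * t
      · by_cases h2 : y = m
        · subst h2
          simp only [if_true, if_neg h1]
          rw [h.symm y x]
          linear_combination l x y * t
        · simp only [if_neg h1, if_neg h2]
          have := h.tri (hadj x hx hx' h1) hxy (hadj y hy hy' h2).symm
          rw [h.symm y m] at this
          linear_combination this
    · push Not at hm
      exact ⟨0, fun hx _ hx' => absurd (hm _ hx) hx'⟩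
  refine ⟨fun x => if x = v then 0 else if G.Adj v x then l v x else r x, ?_, ?_, ?_⟩
  · intro x hx
    simp only [if_true, if_neg hx.ne', if_pos hx]
    linear_combination l v x * two_eq_zero_zmod_two
  · intro x y hx hy hxy
    simp only [if_neg hx.ne', if_neg hy.ne', if_pos hx, if_pos hy]
    have := h.tri hx hxy hy.symm
    rw [h.symm y v] at this
    linear_combination this
  · intro x y hx hy hx' hy' hxy
    simp only [if_neg hx, if_neg hy, if_neg hx', if_neg hy']
    exact hr hx hy hx' hy' hxy

theorem exists_coboundary_of_complete (h : HasCycleSums G l ε) {v : V}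
    (hv : ∀ x, x ≠ v → G.Adj v x) :
    ∃ s : V → ZMod 2, ∀ x y, G.Adj x y → l x y = s x + s y := by
  classical
  have t := two_eq_zero_zmod_two
  refine ⟨fun x => if x = v then 0 else l v x, fun x y hxy => ?_⟩
  by_cases hx : x = v
  · subst hx
    simp [hxy.ne']
  · by_cases hy : y = v
    · subst hy
      simp [hx, h.symm x y]
    · simp only [if_neg hx, if_neg hy]
      have := h.tri (hv x hx) hxy (hv y hy).symm
      rw [h.symm y v] at this
      linear_combination this - (l v x + l v y) * t

theorem label_eq_of_common_right (h : HasCycleSums G l ε) {v : V}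
    (hn : IsNormal G l v) {x y m : V} (hx : G.Adj v x) (hy : G.Adj v y)
    (hxy : G.Adj x y) (hxm : G.Adj x m) (hym : G.Adj y m) : l x m = l y m := by
  have h1 := h.tri hxm hym.symm hxy.symm
  rw [h.symm y x, hn.inner hx hy hxy, h.symm m y] at h1
  linear_combination h1 - l y m * two_eq_zero_zmod_two

theorem label_eq_of_common_left (h : HasCycleSums G l ε) (hG : NoIndepTriple G)
    {v : V} (hn : IsNormal G l v) {x m m' : V} (hm : m ≠ v) (hm' : m' ≠ v) (hvm : ¬ G.Adj v m)
    (hvm' : ¬ G.Adj v m') (hxm : G.Adj x m) (hxm' : G.Adj x m') : l x m = l x m' := by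
  by_cases hne : m = m'
  · rw [hne]
  have hmm := hG.adj_of_not_adj hm hm' hvm hvm' hne
  have h1 := h.tri hxm hmm hxm'.symm
  rw [hn.outer hm hm' hvm hvm' hmm, h.symm m' x] at h1
  linear_combination h1 - l x m' * two_eq_zero_zmod_two

/-- The path `x v y` closes up outside the neighbourhood of `v`, through one common neighbour or
through the edge `m m'`, to an induced cycle of length four or five. Normality leaves only the two
crossing labels in its sum. -/
theorem label_add_of_not_adj (h : HasCycleSums G l ε) (hG : NoIndepTriple G)
    {v : V} (hn : IsNormal G l v) {x y m m' : V} (hx : G.Adj v x) (hy : G.Adj v y)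
    (hm : m ≠ v) (hm' : m' ≠ v) (hvm : ¬ G.Adj v m) (hvm' : ¬ G.Adj v m')
    (hne : x ≠ y) (hxy : ¬ G.Adj x y) (hxm : G.Adj x m) (hym : G.Adj y m') :
    l x m + l y m' = ε := by
  have key : ∀ n, n ≠ v → ¬ G.Adj v n → G.Adj x n → G.Adj y n → l x n + l y n = ε := by
    intro n hnv hvn hxn hyn
    have h1 := h.quad hx hxn hyn.symm hy.symm hnv.symm hne hvn hxy
    rw [hn.star hx, h.symm y v, hn.star hy, h.symm n y] at h1
    linear_combination h1
  by_cases h1 : G.Adj x m'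
  · rw [h.label_eq_of_common_left hG hn hm hm' hvm hvm' hxm h1]
    exact key m' hm' hvm' h1 hym
  by_cases h2 : G.Adj y m
  · rw [h.label_eq_of_common_left hG hn hm' hm hvm' hvm hym h2]
    exact key m hm hvm hxm h2
  have hmm : G.Adj m m' := hG.adj_of_not_adj hm hm' hvm hvm' (by rintro rfl; exact h1 hxm)
  have h3 := h.pent hx hxm hmm hym.symm hy.symm hvm h1 (fun e => h2 e.symm)
    (fun e => hvm' e.symm) (fun e => hxy e.symm)
  rw [hn.star hx, h.symm y v, hn.star hy, hn.outer hm hm' hvm hvm' hmm, h.symm m' y] at h3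
  linear_combination h3

/-- If `x` and `y` have no common neighbour among `m`, `m'`, then `x m m' y` is an induced 4-cycle.
This is where `ε = 0` is needed. -/
theorem label_eq_of_adj (h : HasCycleSums G l ε) (hG : NoIndepTriple G)
    {v : V} (hn : IsNormal G l v) {x y m m' : V} (hx : G.Adj v x) (hy : G.Adj v y)
    (hm : m ≠ v) (hm' : m' ≠ v) (hvm : ¬ G.Adj v m) (hvm' : ¬ G.Adj v m')
    (hε : ε = 0) (hxy : G.Adj x y) (hxm : G.Adj x m) (hym : G.Adj y m') :
    l x m = l y m' := by
  by_cases h1 : G.Adj x m'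
  · rw [h.label_eq_of_common_left hG hn hm hm' hvm hvm' hxm h1]
    exact h.label_eq_of_common_right hn hx hy hxy h1 hym
  by_cases h2 : G.Adj y m
  · rw [h.label_eq_of_common_left hG hn hm' hm hvm' hvm hym h2]
    exact h.label_eq_of_common_right hn hx hy hxy hxm h2
  have hmm : G.Adj m m' := hG.adj_of_not_adj hm hm' hvm hvm' (by rintro rfl; exact h1 hxm)
  have h3 := h.quad hxm hmm hym.symm hxy.symm (by rintro rfl; exact hvm' hx)
    (by rintro rfl; exact hvm hy) h1 (fun e => h2 e.symm)
  rw [h.symm y x, hn.inner hx hy hxy, hn.outer hm hm' hvm hvm' hmm, h.symm m' y, hε] at h3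
  linear_combination h3 - l y m' * two_eq_zero_zmod_two

/-- In a graph without independent triples, a function that sums to zero on all induced cycles is
a coboundary. -/
theorem exists_coboundary (h : HasCycleSums G l 0) (hG : NoIndepTriple G) :
    ∃ s : V → ZMod 2, ∀ x y, G.Adj x y → l x y = s x + s y := by
  classical
  rcases isEmpty_or_nonempty V with hV | ⟨⟨v⟩⟩
  · exact ⟨0, fun x => hV.elim x⟩
  obtain ⟨s, hs⟩ := h.exists_isNormal hG v
  have h' := h.switch s
  have t := two_eq_zero_zmod_two
  suffices ∃ r : V → ZMod 2, ∀ x y, G.Adj x y → l x y + s x + s y = r x + r y by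
    obtain ⟨r, hr⟩ := this
    refine ⟨fun x => r x + s x, fun x y hxy => ?_⟩
    linear_combination hr x y hxy - (s x + s y) * t
  set l' : V → V → ZMod 2 := fun x y => l x y + s x + s y with hl'
  suffices ∃ r : V → ZMod 2, ∀ x y, G.Adj x y → l' x y = r x + r y from this
  -- All labels between neighbours and non-neighbours of `v` agree; `c` times the indicator of the
  -- non-neighbours is then a potential.
  obtain ⟨c, hc⟩ : ∃ c : ZMod 2, ∀ x m, G.Adj v x → m ≠ v → ¬ G.Adj v m → G.Adj x m →
      l' x m = c := by
    by_cases hex : ∃ x m, G.Adj v x ∧ m ≠ v ∧ ¬ G.Adj v m ∧ G.Adj x m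
    · obtain ⟨x, m, hx, hm, hvm, hxm⟩ := hex
      refine ⟨l' x m, fun y m' hy hm' hvm' hym => ?_⟩
      by_cases hxy : x = y
      · subst hxy
        exact h'.label_eq_of_common_left hG hs hm' hm hvm' hvm hym hxm
      by_cases hadj : G.Adj x y
      · exact (h'.label_eq_of_adj hG hs hx hy hm hm' hvm hvm' rfl hadj hxm hym).symm
      · have := h'.label_add_of_not_adj hG hs hx hy hm hm' hvm hvm' hxy hadj hxm hym
        change l' x m + l' y m' = 0 at this
        linear_combination this - l' x m * t
    · exact ⟨0, fun x m h1 h2 h3 h4 => absurd ⟨x, m, h1, h2, h3, h4⟩ hex⟩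
  refine ⟨fun x => if x ≠ v ∧ ¬ G.Adj v x then c else 0, fun x y hxy => ?_⟩
  by_cases hx : x ≠ v ∧ ¬ G.Adj v x <;> by_cases hy : y ≠ v ∧ ¬ G.Adj v y
  · simp only [if_pos hx, if_pos hy]
    linear_combination hs.outer hx.1 hy.1 hx.2 hy.2 hxy - c * t
  · simp only [if_pos hx, if_neg hy, add_zero]
    have hvy : G.Adj v y := by
      by_contra hvy
      have : y = v := by tauto
      subst this
      exact hx.2 hxy.symm
    rw [h'.symm]
    exact hc y x hvy hx.1 hx.2 hxy.symm
  · simp only [if_pos hy, if_neg hx, zero_add]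
    have hvx : G.Adj v x := by
      by_contra hvx
      have : x = v := by tauto
      subst this
      exact hy.2 hxy
    exact hc x y hvx hy.1 hy.2 hxy
  · simp only [if_neg hx, if_neg hy, add_zero]
    by_cases hxv : x = v
    · subst hxv; exact hs.star hxy
    · by_cases hyv : y = v
      · subst hyv; rw [h'.symm]; exact hs.star hxy.symm
      · exact hs.inner (by tauto) (by tauto) hxy

end HasCycleSums

/-! ### Partition into three cliques -/

/-- The indicator of the pair of classes `0`, `2`. -/
def wrapLabel (i j : Fin 3) : ZMod 2 := if (i = 0 ∧ j = 2) ∨ (i = 2 ∧ j = 0) then 1 else 0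

/-- A partition into three cliques, indexed by `a`, together with a switching `s` that turns
`l` into the labelling by `1` between the classes `0` and `2` and by `0` elsewhere. -/
structure IsCliquePartition {V : Type*} (G : SimpleGraph V) (l : V → V → ZMod 2) (a : V → Fin 3)
    (s : V → ZMod 2) : Prop where
  clique : ∀ x y, x ≠ y → a x = a y → G.Adj x y
  label : ∀ x y, G.Adj x y → l x y = wrapLabel (a x) (a y) + s x + s y

/-- Normalise at a vertex `v` that has a non-neighbour. A neighbour of `v` sends the same label to
all its neighbours outside, and non-adjacent ones send different labels. So label 1 indicates class
0, label 0 indicates class 1 (which also contains `v`), and the non-neighbours of `v` form class 2.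
-/
theorem HasCycleSums.exists_isCliquePartition {V : Type*} {G : SimpleGraph V}
    {l : V → V → ZMod 2} (h : HasCycleSums G l 1) (hG : NoIndepTriple G) :
    ∃ a s, IsCliquePartition G l a s := by
  classical
  have t := two_eq_zero_zmod_two
  by_cases hcomp : ∀ x y, x ≠ y → G.Adj x y
  · rcases isEmpty_or_nonempty V with hV | ⟨⟨v⟩⟩
    · exact ⟨0, 0, fun x => hV.elim x, fun x => hV.elim x⟩
    obtain ⟨s, hs⟩ := h.exists_coboundary_of_complete (v := v) (fun x hx => hcomp v x hx.symm)
    refine ⟨0, s, fun x y hxy _ => hcomp x y hxy, fun x y hxy => ?_⟩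
    rw [hs x y hxy]
    simp [wrapLabel]
  push Not at hcomp
  obtain ⟨v, m₀, hvm, hm₀⟩ := hcomp
  obtain ⟨s, hs⟩ := h.exists_isNormal hG v
  have h' := h.switch s
  set l' : V → V → ZMod 2 := fun x y => l x y + s x + s y with hl'
  suffices ∃ a : V → Fin 3, (∀ x y, x ≠ y → a x = a y → G.Adj x y) ∧
      ∀ x y, G.Adj x y → l' x y = wrapLabel (a x) (a y) by
    obtain ⟨a, h1, h2⟩ := this
    refine ⟨a, s, h1, fun x y hxy => ?_⟩
    linear_combination h2 x y hxy - (s x + s y) * t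
  let T : ZMod 2 → V → Prop := fun c x => ∃ m, m ≠ v ∧ ¬ G.Adj v m ∧ G.Adj x m ∧ l' x m = c
  have hT : ∀ {x c d}, T c x → T d x → c = d := by
    rintro x c d ⟨m, hm, hvm, hxm, rfl⟩ ⟨m', hm', hvm', hxm', rfl⟩
    exact h'.label_eq_of_common_left hG hs hm hm' hvm hvm' hxm hxm'
  have hTT : ∀ {x y c d}, G.Adj v x → G.Adj v y → x ≠ y → ¬ G.Adj x y → T c x → T d y →
      c + d = 1 := by
    rintro x y c d hx hy hne hxy ⟨m, hm, hvm, hxm, rfl⟩ ⟨m', hm', hvm', hym', rfl⟩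
    exact h'.label_add_of_not_adj hG hs hx hy hm hm' hvm hvm' hne hxy hxm hym'
  have hfree : ∀ x, ¬ T 0 x → ¬ T 1 x → ∀ m, m ≠ v → ¬ G.Adj v m → ¬ G.Adj x m := by
    intro x h0 h1 m hm hvm hxm
    rcases zmod_two_eq_zero_or_one (l' x m) with e | e
    · exact h0 ⟨m, hm, hvm, hxm, e⟩
    · exact h1 ⟨m, hm, hvm, hxm, e⟩
  -- `L` will be class 0. A vertex without neighbours outside has no label to decide its class; it
  -- joins `L` exactly when some label-0 vertex is not adjacent to it.
  let L : V → Prop := fun x => T 1 x ∨ ∃ y, G.Adj v y ∧ T 0 y ∧ y ≠ x ∧ ¬ G.Adj x y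
  have hLT : ∀ {x}, G.Adj v x → L x → ¬ T 0 x := by
    rintro x hx (h1 | ⟨y, hy, h0, hne, hxy⟩) h0'
    · exact absurd (hT h1 h0') (by decide)
    · exact absurd (hTT hx hy hne.symm hxy h0' h0) (by decide)
  -- two distinct vertices without neighbours outside are adjacent
  have hFF : ∀ {x y}, G.Adj v x → G.Adj v y → ¬ T 0 x → ¬ T 1 x → ¬ T 0 y → ¬ T 1 y → x ≠ y →
      G.Adj x y := by
    intro x y hx hy h1 h2 h3 h4 hne
    have hx0 := hfree x h1 h2 m₀ hvm.symm hm₀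
    have hy0 := hfree y h3 h4 m₀ hvm.symm hm₀
    rcases hG x y m₀ hne (by rintro rfl; exact hm₀ hy) (by rintro rfl; exact hm₀ hx)
      with e | e | e
    · exact e
    · exact absurd e hy0
    · exact absurd e.symm hx0
  have hFL : ∀ {x y}, G.Adj v x → G.Adj v y → T 1 x → ¬ T 1 y → L y → x ≠ y → G.Adj x y := by
    intro x y hx hy h1x h1y hLy hne
    -- Since `y` misses `x`, `z` and `m₀`, the absence of independent triples makes `x`, `z`, `m₀` a
    -- triangle. Then `x` and `z` send the same label to `m₀`, although one sends 1 and the other 0.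
    by_contra hxy
    rcases id hLy with h1 | ⟨z, hz, h0z, hzy, hyz⟩
    · exact h1y h1
    have hy0 := hLT hy hLy
    have hym := hfree y hy0 h1y m₀ hvm.symm hm₀
    have ym : y ≠ m₀ := by rintro rfl; exact hm₀ hy
    have xm : x ≠ m₀ := by rintro rfl; exact hm₀ hx
    have zm : z ≠ m₀ := by rintro rfl; exact hm₀ hz
    have hxz : x ≠ z := by rintro rfl; exact absurd (hT h1x h0z) (by decide)
    have a1 : G.Adj x m₀ := by
      rcases hG x y m₀ hne ym xm.symm with e | e | e
      · exact absurd e hxy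
      · exact absurd e hym
      · exact e.symm
    have a2 : G.Adj z m₀ := by
      rcases hG z y m₀ hzy ym zm.symm with e | e | e
      · exact absurd e.symm hyz
      · exact absurd e hym
      · exact e.symm
    have a3 : G.Adj x z := by
      rcases hG x y z hne hzy.symm hxz.symm with e | e | e
      · exact absurd e hxy
      · exact absurd e hyz
      · exact e.symm
    have e1 := h'.label_eq_of_common_right hs hx hz a3 a1 a2
    have e2 : (1 : ZMod 2) = l' x m₀ := hT h1x ⟨m₀, hvm.symm, hm₀, a1, rfl⟩
    have e3 : (0 : ZMod 2) = l' z m₀ := hT h0z ⟨m₀, hvm.symm, hm₀, a2, rfl⟩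
    rw [← e2, ← e3] at e1
    exact absurd e1 (by decide)
  have hLL : ∀ {x y}, G.Adj v x → G.Adj v y → L x → L y → x ≠ y → G.Adj x y := by
    intro x y hx hy hLx hLy hne
    by_cases h1 : T 1 x <;> by_cases h2 : T 1 y
    · by_contra hxy
      exact absurd (hTT hx hy hne hxy h1 h2) (by decide)
    · exact hFL hx hy h1 h2 hLy hne
    · exact (hFL hy hx h2 h1 hLx hne.symm).symm
    · exact hFF hx hy (hLT hx hLx) h1 (hLT hy hLy) h2 hne
  have hRR : ∀ {x y}, G.Adj v x → G.Adj v y → ¬ L x → ¬ L y → x ≠ y → G.Adj x y := by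
    intro x y hx hy hLx hLy hne
    by_contra hxy
    have h1 : ¬ T 0 y := fun e => hLx (Or.inr ⟨y, hy, e, hne.symm, hxy⟩)
    have h2 : ¬ T 0 x := fun e => hLy (Or.inr ⟨x, hx, e, hne, fun e => hxy e.symm⟩)
    exact hxy (hFF hx hy h2 (fun e => hLx (Or.inl e)) h1 (fun e => hLy (Or.inl e)) hne)
  have hLM : ∀ {x m}, G.Adj v x → L x → m ≠ v → ¬ G.Adj v m → G.Adj x m → l' x m = 1 := by
    intro x m hx hLx hm hvm hxm
    rcases zmod_two_eq_zero_or_one (l' x m) with e | e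
    · exact absurd ⟨m, hm, hvm, hxm, e⟩ (hLT hx hLx)
    · exact e
  have hRM : ∀ {x m}, ¬ L x → m ≠ v → ¬ G.Adj v m → G.Adj x m → l' x m = 0 := by
    intro x m hLx hm hvm hxm
    rcases zmod_two_eq_zero_or_one (l' x m) with e | e
    · exact e
    · exact absurd (Or.inl ⟨m, hm, hvm, hxm, e⟩) hLx
  have hlv : ∀ {x}, G.Adj v x → l' v x = 0 := fun hx => hs.star hx
  have hin : ∀ {x y}, G.Adj v x → G.Adj v y → G.Adj x y → l' x y = 0 :=
    fun hx hy hxy => hs.inner hx hy hxy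
  have hout : ∀ {x y}, x ≠ v → y ≠ v → ¬ G.Adj v x → ¬ G.Adj v y → G.Adj x y → l' x y = 0 :=
    fun h1 h2 h3 h4 h5 => hs.outer h1 h2 h3 h4 h5
  have hsymm : ∀ x y, l' x y = l' y x := h'.symm
  have hMM : ∀ {x y}, x ≠ v → y ≠ v → ¬ G.Adj v x → ¬ G.Adj v y → x ≠ y → G.Adj x y :=
    fun h1 h2 h3 h4 h5 => hG.adj_of_not_adj h1 h2 h3 h4 h5
  clear_value l' L
  clear hFL hFF hLT hfree hTT hT hs h'
  refine ⟨fun x => if x = v then 1 else if G.Adj v x then (if L x then 0 else 1) else 2,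
    fun x y hxy ha => ?_, fun x y hxy => ?_⟩
  · by_cases hx : x = v
    · subst hx
      by_cases hy : G.Adj x y
      · exact hy
      · simp [hxy.symm, hy] at ha
    · by_cases hy : y = v
      · subst hy
        by_cases hx' : G.Adj y x
        · exact hx'.symm
        · simp [hx, hx'] at ha
      · simp only [if_neg hx, if_neg hy] at ha
        by_cases hx' : G.Adj v x <;> by_cases hy' : G.Adj v y <;> by_cases h1 : L x <;>
          by_cases h2 : L y <;> simp [hx', hy', h1, h2] at ha <;>
          first
          | exact hLL hx' hy' h1 h2 hxy
          | exact hRR hx' hy' h1 h2 hxy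
          | exact hMM hx hy hx' hy' hxy
  · by_cases hx : x = v
    · subst hx
      rw [hlv hxy]
      by_cases h2 : L y <;> simp [hxy, hxy.ne', h2, wrapLabel]
    · by_cases hy : y = v
      · subst hy
        rw [hsymm, hlv hxy.symm]
        by_cases h1 : L x <;> simp [hxy.symm, hx, h1, wrapLabel]
      · simp only [if_neg hx, if_neg hy]
        by_cases hx' : G.Adj v x <;> by_cases hy' : G.Adj v y
        · rw [hin hx' hy' hxy]
          by_cases h1 : L x <;> by_cases h2 : L y <;> simp [hx', hy', h1, h2, wrapLabel]
        · by_cases h1 : L x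
          · rw [hLM hx' h1 hy hy' hxy]
            simp [hx', hy', h1, wrapLabel]
          · rw [hRM h1 hy hy' hxy]
            simp [hx', hy', h1, wrapLabel]
        · rw [hsymm]
          by_cases h1 : L y
          · rw [hLM hy' h1 hx hx' hxy.symm]
            simp [hx', hy', h1, wrapLabel]
          · rw [hRM h1 hx hx' hxy.symm]
            simp [hx', hy', h1, wrapLabel]
        · rw [hout hx hy hx' hy' hxy]
          simp [hx', hy', wrapLabel]

/-! ### Acyclic orientations and the order of the offsets -/

/-- A finite multipartite tournament without directed cycles of length three and four is
acyclic, so its vertices can be numbered along the arcs. -/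
theorem exists_numbering_of_multipartite_tournament {V κ : Type*} [Finite V] (a : V → κ)
    (r : V → V → Prop) (hne : ∀ {x y}, r x y → a x ≠ a y)
    (htot : ∀ {x y}, a x ≠ a y → r x y ∨ r y x) (h2 : ∀ {x y}, r x y → ¬ r y x)
    (h3 : ∀ {x y z}, r x y → r y z → ¬ r z x)
    (h4 : ∀ {x y z w}, r x y → r y z → r z w → ¬ r w x) :
    ∃ c : V → ℕ, Function.Injective c ∧ ∀ {x y}, r x y → c x < c y := by
  classical
  have := Fintype.ofFinite V
  -- Comparing vertices of one class through an intermediate vertex makes the relation transitive;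
  -- the chords needed for this come from the absence of directed 3- and 4-cycles.
  let lt : V → V → Prop := fun x y => r x y ∨ (a x = a y ∧ ∃ z, r x z ∧ r z y)
  have hirr : ∀ x, ¬ lt x x := by
    rintro x (h | ⟨-, z, h, h'⟩)
    · exact h2 h h
    · exact h2 h h'
  have htrans : ∀ {x y z}, lt x y → lt y z → lt x z := by
    rintro x y z (hxy | ⟨exy, w, hxw, hwy⟩) (hyz | ⟨eyz, u, hyu, huz⟩)
    · by_cases e : a x = a z
      · exact Or.inr ⟨e, y, hxy, hyz⟩
      · exact Or.inl ((htot e).resolve_right (h3 hxy hyz))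
    · have e : a x ≠ a z := eyz ▸ hne hxy
      exact Or.inl ((htot e).resolve_right (h4 hxy hyu huz))
    · have e : a x ≠ a z := exy ▸ hne hyz
      exact Or.inl ((htot e).resolve_right (h4 hxw hwy hyz))
    · have e : a x ≠ a u := exy ▸ hne hyu
      exact Or.inr ⟨exy.trans eyz, u, (htot e).resolve_right (h4 hxw hwy hyu), huz⟩
  let e := Fintype.equivFin V
  let d : V → ℕ := fun x => (Finset.univ.filter fun y => lt y x).card
  have hd : ∀ {x y}, r x y → d x < d y := by
    intro x y hxy
    refine Finset.card_lt_card ⟨fun z hz => ?_, fun hsub => ?_⟩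
    · simp only [Finset.mem_filter, Finset.mem_univ, true_and] at hz ⊢
      exact htrans hz (Or.inl hxy)
    · have : x ∈ Finset.univ.filter fun z => lt z x :=
        hsub (by simpa using (Or.inl hxy : lt x y))
      exact hirr x (by simpa using this)
  -- The number of predecessors increases along arcs; an enumeration of the vertices breaks ties to
  -- give injectivity.
  refine ⟨fun x => d x * Fintype.card V + e x, fun x y hxy => ?_, fun {x y} hxy => ?_⟩
  · have hx := (e x).2
    have hy := (e y).2
    have h := congrArg (· % Fintype.card V) hxy
    simp only [Nat.mul_add_mod_self_right, Nat.mod_eq_of_lt hx, Nat.mod_eq_of_lt hy] at h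
    exact e.injective (Fin.ext h)
  · have hx := (e x).2
    have := Nat.mul_le_mul_right (Fintype.card V) (hd hxy)
    simp only [Nat.succ_mul] at this
    change d x * Fintype.card V + e x < d y * Fintype.card V + e y
    omega

/-- The orientation of the pairs of vertices in different classes along which the fractional
parts of the positions have to increase. -/
def Precedes {V : Type*} (G : SimpleGraph V) (a : V → Fin 3) (x y : V) : Prop :=
  (a y = a x + 1 ∧ ¬ G.Adj x y) ∨ (a x = a y + 1 ∧ G.Adj x y)

/-- A directed triangle would be either an independent triple or a triangle meeting all three
classes. A directed 4-cycle would yield one of these two or an induced 4-cycle on two classes, whose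
label sum is 0 instead of 1. -/
theorem IsCliquePartition.exists_numbering {V : Type*} [Finite V] {G : SimpleGraph V}
    {l : V → V → ZMod 2} {a : V → Fin 3} {s : V → ZMod 2} (ha : IsCliquePartition G l a s)
    (h : HasCycleSums G l 1) (hG : NoIndepTriple G) :
    ∃ c : V → ℕ, Function.Injective c ∧ ∀ {x y}, Precedes G a x y → c x < c y := by
  have t := two_eq_zero_zmod_two
  have f1 : ∀ i : Fin 3, i ≠ i + 1 := by decide
  have f2 : ∀ i j : Fin 3, i = j + 1 → j = i + 1 → False := by decide
  have f3 : ∀ i j : Fin 3, i ≠ j → j = i + 1 ∨ i = j + 1 := by decide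
  have hne : ∀ {x y}, Precedes G a x y → a x ≠ a y := by
    rintro x y (⟨e, -⟩ | ⟨e, -⟩) h
    · exact f1 (a x) (by rw [← e, h])
    · exact f1 (a y) (by rw [← e, h])
  have htot : ∀ {x y}, a x ≠ a y → Precedes G a x y ∨ Precedes G a y x := by
    intro x y hxy
    unfold Precedes
    have := G.adj_comm x y
    have := f3 _ _ hxy
    tauto
  have h2 : ∀ {x y}, Precedes G a x y → ¬ Precedes G a y x := by
    rintro x y (⟨e, n⟩ | ⟨e, n⟩) (⟨e', n'⟩ | ⟨e', n'⟩)
    · exact f2 _ _ e' e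
    · exact n n'.symm
    · exact n' n.symm
    · exact f2 _ _ e e'
  -- Exactly one of the three edges joins classes 0 and 2, so the label sum would be 1.
  have htr : ∀ {x y z}, G.Adj x y → G.Adj y z → G.Adj z x → a x ≠ a y → a y ≠ a z → a z ≠ a x →
      False := by
    intro x y z hxy hyz hzx n1 n2 n3
    have h1 := h.tri hxy hyz hzx
    rw [ha.label _ _ hxy, ha.label _ _ hyz, ha.label _ _ hzx] at h1
    have h2 : wrapLabel (a x) (a y) + wrapLabel (a y) (a z) + wrapLabel (a z) (a x) = 0 := by
      linear_combination h1 - (s x + s y + s z) * t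
    have : ∀ i j k : Fin 3, i ≠ j → j ≠ k → k ≠ i →
      wrapLabel i j + wrapLabel j k + wrapLabel k i ≠ 0 := by unfold wrapLabel; decide
    exact this _ _ _ n1 n2 n3 h2
  have h3 : ∀ {x y z}, Precedes G a x y → Precedes G a y z → ¬ Precedes G a z x := by
    intro x y z p q r
    have n1 := hne p
    have n2 := hne q
    have n3 := hne r
    have hd : ∀ {u v}, a u ≠ a v → u ≠ v := fun h e => h (by rw [e])
    have c : ∀ i j k : Fin 3, i ≠ j → j ≠ k → k ≠ i →
      (j = i + 1 ∧ k = j + 1 ∧ i = k + 1) ∨ (i = j + 1 ∧ j = k + 1 ∧ k = i + 1) := by decide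
    rcases c _ _ _ n1 n2 n3 with ⟨e1, e2, e3⟩ | ⟨e1, e2, e3⟩
    · have m1 := (p.resolve_right fun e => f2 _ _ e.1 e1).2
      have m2 := (q.resolve_right fun e => f2 _ _ e.1 e2).2
      have m3 := (r.resolve_right fun e => f2 _ _ e.1 e3).2
      rcases hG x y z (hd n1) (hd n2) (hd n3) with e | e | e
      exacts [m1 e, m2 e, m3 e]
    · have m1 := (p.resolve_left fun e => f2 _ _ e1 e.1).2
      have m2 := (q.resolve_left fun e => f2 _ _ e2 e.1).2
      have m3 := (r.resolve_left fun e => f2 _ _ e3 e.1).2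
      exact htr m1 m2 m3 n1 n2 n3
  -- the only possible directed 4-cycles run between two classes
  have hsq : ∀ {x y z w}, a x = a z → a y = a w → a y = a x + 1 → Precedes G a x y →
      Precedes G a y z → Precedes G a z w → Precedes G a w x → False := by
    intro x y z w exz eyw e p q r u
    have m1 := (p.resolve_right fun e' => f2 _ _ e'.1 e).2
    have m2 := (q.resolve_left fun e' => f2 _ _ e (exz.trans e'.1)).2
    have m3 := (r.resolve_right fun e' => f2 _ _ (eyw ▸ exz ▸ e'.1) e).2
    have m4 := (u.resolve_left fun e' => f2 _ _ e (eyw ▸ e'.1)).2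
    have nxz : x ≠ z := by rintro rfl; exact m1 m2.symm
    have nyw : y ≠ w := by rintro rfl; exact m3 m2.symm
    have k1 := ha.clique x z nxz exz
    have k2 := ha.clique y w nyw eyw
    have h1 := h.quad k1 m2.symm k2 m4 (fun e' => hne p (by rw [e'])) (fun e' => hne r (by rw [e']))
      m1 m3
    rw [ha.label _ _ k1, ha.label _ _ m2.symm, ha.label _ _ k2, ha.label _ _ m4, ← exz, ← eyw] at h1
    have h2 : wrapLabel (a x) (a x) + wrapLabel (a x) (a y) + wrapLabel (a y) (a y) +
        wrapLabel (a y) (a x) = 1 := by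
      linear_combination h1 - (s x + s y + s z + s w) * t
    have : ∀ i j : Fin 3, wrapLabel i i + wrapLabel i j + wrapLabel j j + wrapLabel j i ≠ 1 := by
      unfold wrapLabel; decide
    exact this _ _ h2
  -- a directed 4-cycle meeting its middle class twice
  have hvee : ∀ {x y z w}, a x = a z → a y ≠ a w → Precedes G a x y →
      Precedes G a y z → Precedes G a z w → Precedes G a w x → a y = a x + 1 → False := by
    intro x y z w exz nyw p q r u e
    have c : ∀ i j k : Fin 3, i ≠ k → j ≠ k → j = i + 1 → i = k + 1 := by decide
    have e' := c _ _ _ (hne u).symm nyw e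
    have m1 := (p.resolve_right fun e1 => f2 _ _ e1.1 e).2
    have m2 := (q.resolve_left fun e1 => f2 _ _ e (exz.trans e1.1)).2
    have m3 := (r.resolve_left fun e1 => f2 _ _ e' (exz ▸ e1.1)).2
    have m4 := (u.resolve_right fun e1 => f2 _ _ e1.1 e').2
    have hyw : ¬ G.Adj y w := fun hyw => htr m2 m3 hyw.symm (hne q) (hne r) nyw.symm
    rcases hG x y w (fun e1 => hne p (by rw [e1])) (fun e1 => nyw (by rw [e1]))
      (fun e1 => hne u (by rw [e1])) with k | k | k
    exacts [m1 k, hyw k, m4 k]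
  have h4' : ∀ {x y z w}, a x = a z → Precedes G a x y → Precedes G a y z → Precedes G a z w →
      ¬ Precedes G a w x := by
    intro x y z w exz p q r u
    by_cases eyw : a y = a w
    · rcases f3 _ _ (hne p) with e | e
      · exact hsq exz eyw e p q r u
      · exact hsq eyw exz.symm (by rw [← exz]; exact e) q r u p
    · rcases f3 _ _ (hne p) with e | e
      · exact hvee exz eyw p q r u e
      · have c : ∀ i j k : Fin 3, i ≠ k → j ≠ k → i = j + 1 → k = i + 1 := by decide
        have := c _ _ _ (hne u).symm eyw e
        exact hvee exz.symm (Ne.symm eyw) r u p q (by rw [← exz]; exact this)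
  refine exists_numbering_of_multipartite_tournament a (Precedes G a) hne htot h2 h3 ?_
  -- If `x` and `z` lie in different classes, the oriented chord between them closes a directed
  -- triangle.
  intro x y z w p q r u
  by_cases exz : a x = a z
  · exact h4' exz p q r u
  · rcases htot exz with k | k
    · exact h3 k r u
    · exact h3 p q k

/-! ### Trees, induced five-cycles and labellings as functions on pairs -/

/-- A parent function that decreases a rank off the root defines a tree. -/
theorem isTree_of_parent {V : Type*} {T : SimpleGraph V} (r : V) (π : V → V) (d : V → ℕ)
    (hd : ∀ x, x ≠ r → d (π x) < d x)
    (hT : ∀ x y, T.Adj x y ↔ (x ≠ r ∧ y = π x) ∨ (y ≠ r ∧ x = π y)) : T.IsTree := by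
  classical
  refine ⟨?_, ?_⟩
  · have hr : ∀ n x, d x = n → T.Reachable x r := by
      intro n
      induction n using Nat.strong_induction_on with
      | _ n ih =>
        rintro x rfl
        by_cases hx : x = r
        · rw [hx]
        · have : T.Adj x (π x) := (hT _ _).2 (Or.inl ⟨hx, rfl⟩)
          exact this.reachable.trans (ih _ (hd x hx) _ rfl)
    exact (SimpleGraph.connected_iff T).2 ⟨fun x y => (hr _ x rfl).trans (hr _ y rfl).symm, ⟨r⟩⟩
  · intro v p hp
    -- At a vertex of maximal rank on a cycle, both cycle neighbours would have to be its parent.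
    obtain ⟨x, hx, hmax⟩ := p.support.toFinset.exists_max_image d
      ⟨v, by simp⟩
    rw [List.mem_toFinset] at hx
    have hq := hp.rotate hx
    set q := p.rotate x hx with hqdef
    have hmem : ∀ y ∈ q.support, d y ≤ d x := by
      intro y hy
      refine hmax y ?_
      rw [List.mem_toFinset]
      exact (SimpleGraph.Walk.mem_support_rotate_iff p x hx).1 hy
    have hpar : ∀ y ∈ q.support, T.Adj x y → y = π x := by
      intro y hy hxy
      rcases (hT _ _).1 hxy with ⟨-, e⟩ | ⟨hyr, e⟩
      · exact e
      · have := hd y hyr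
        rw [← e] at this
        exact absurd (hmem y hy) (by omega)
    have h1 := hpar _ (q.getVert_mem_support 1) (q.adj_snd hq.not_nil)
    have h2 := hpar _ (q.getVert_mem_support _) (q.adj_penultimate hq.not_nil).symm
    exact hq.snd_ne_penultimate (h1.trans h2.symm)

theorem noIndepTriple_of_indepSetFree {V : Type*} {G : SimpleGraph V} (h : G.IndepSetFree 3) :
    NoIndepTriple G := by
  classical
  intro x y z hxy hyz hzx
  by_contra hc
  push Not at hc
  obtain ⟨h1, h2, h3⟩ := hc
  have h1' := mt G.adj_symm h1
  have h2' := mt G.adj_symm h2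
  have h3' := mt G.adj_symm h3
  refine h {x, y, z} ⟨?_, Finset.card_eq_three.2 ⟨x, y, z, hxy, hzx.symm, hyz, rfl⟩⟩
  intro u hu w hw _
  simp only [Finset.coe_insert, Finset.coe_singleton, Set.mem_insert_iff,
    Set.mem_singleton_iff] at hu hw
  rcases hu with rfl | rfl | rfl <;> rcases hw with rfl | rfl | rfl <;>
    first | exact G.loopless.irrefl _ | assumption

theorem exists_cycleGraph_five_embedding {V : Type*} {G : SimpleGraph V} {a b c d e : V}
    (h1 : G.Adj a b) (h2 : G.Adj b c) (h3 : G.Adj c d) (h4 : G.Adj d e) (h5 : G.Adj e a)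
    (k1 : ¬ G.Adj a c) (k2 : ¬ G.Adj b d) (k3 : ¬ G.Adj c e) (k4 : ¬ G.Adj d a)
    (k5 : ¬ G.Adj e b) :
    ∃ f : cycleGraph 5 ↪g G, f 0 = a ∧ f 1 = b ∧ f 2 = c ∧ f 3 = d ∧ f 4 = e := by
  have k1' := mt G.adj_symm k1
  have k2' := mt G.adj_symm k2
  have k3' := mt G.adj_symm k3
  have k4' := mt G.adj_symm k4
  have k5' := mt G.adj_symm k5
  have hf : ∀ i j : Fin 5,
      G.Adj (![a, b, c, d, e] i) (![a, b, c, d, e] j) ↔ (cycleGraph 5).Adj i j := by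
    intro i j
    fin_cases i <;> fin_cases j <;>
      simp [h1, h2, h3, h4, h5, h1.symm, h2.symm, h3.symm, h4.symm, h5.symm, k1, k2, k3, k4, k5,
        k1', k2', k3', k4', k5', cycleGraph_adj] <;> decide
  have n1 : a ≠ c := by rintro rfl; exact k4 h3.symm
  have n2 : b ≠ d := by rintro rfl; exact k5 h4.symm
  have n3 : c ≠ e := by rintro rfl; exact k1 h5.symm
  have n4 : d ≠ a := by rintro rfl; exact k2 h1.symm
  have n5 : e ≠ b := by rintro rfl; exact k3 h2.symm
  have hinj : Function.Injective ![a, b, c, d, e] := by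
    intro i j hij
    fin_cases i <;> fin_cases j <;> simp at hij ⊢ <;>
      first
      | exact h1.ne hij | exact h1.ne' hij | exact h2.ne hij | exact h2.ne' hij
      | exact h3.ne hij | exact h3.ne' hij | exact h4.ne hij | exact h4.ne' hij
      | exact h5.ne hij | exact h5.ne' hij
      | exact n1 hij | exact n1.symm hij | exact n2 hij | exact n2.symm hij
      | exact n3 hij | exact n3.symm hij | exact n4 hij | exact n4.symm hij
      | exact n5 hij | exact n5.symm hij
  exact ⟨⟨⟨![a, b, c, d, e], hinj⟩, hf _ _⟩, rfl, rfl, rfl, rfl, rfl⟩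

namespace Labelling

variable {V : Type*} {G : SimpleGraph V}

open Classical in
/-- A labelling as a function of two vertices, with value zero off the edges. -/
def onPairs (σ : Labelling G) (x y : V) : ZMod 2 :=
  if h : G.Adj x y then σ ⟨s(x, y), h⟩ else 0

theorem onPairs_of_adj (σ : Labelling G) {x y : V} (h : G.Adj x y) :
    σ.onPairs x y = σ ⟨s(x, y), h⟩ := dif_pos h

theorem onPairs_comm (σ : Labelling G) (x y : V) : σ.onPairs x y = σ.onPairs y x := by
  by_cases h : G.Adj x y
  · rw [σ.onPairs_of_adj h, σ.onPairs_of_adj h.symm]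
    congr 1
    exact Subtype.ext Sym2.eq_swap
  · rw [onPairs, onPairs, dif_neg h, dif_neg (fun e => h e.symm)]

theorem ext_onPairs {σ τ : Labelling G} (h : ∀ x y, G.Adj x y → σ.onPairs x y = τ.onPairs x y) :
    σ = τ := by
  funext ⟨e, he⟩
  induction e with
  | _ x y =>
    have := h x y he
    rwa [onPairs_of_adj σ he, onPairs_of_adj τ he] at this

theorem onPairs_pullback {W : Type*} {H : SimpleGraph W} (σ : Labelling G) (f : H ↪g G) {x y : W}
    (h : H.Adj x y) : (σ.pullback f).onPairs x y = σ.onPairs (f x) (f y) := by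
  rw [onPairs_of_adj _ h, onPairs_of_adj _ (f.map_rel_iff.2 h)]
  rfl

theorem finsum_pullback {n : ℕ} [NeZero n] (hadj : ∀ i : Fin n, (cycleGraph n).Adj i (i + 1))
    (hb : Function.Bijective fun i : Fin n => (⟨s(i, i + 1), hadj i⟩ : (cycleGraph n).edgeSet))
    (σ : Labelling G) (f : cycleGraph n ↪g G) :
    ∑ᶠ e : (cycleGraph n).edgeSet, σ.pullback f e = ∑ i, σ.onPairs (f i) (f (i + 1)) := by
  rw [← finsum_eq_of_bijective (f := fun i => σ.onPairs (f i) (f (i + 1))) _ hb fun i => ?_,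
    finsum_eq_sum_of_fintype]
  rw [← onPairs_pullback σ f (hadj i), onPairs_of_adj _ (hadj i)]

theorem finsum_pullback_three (σ : Labelling G) (f : cycleGraph 3 ↪g G) :
    ∑ᶠ e : (cycleGraph 3).edgeSet, σ.pullback f e =
      σ.onPairs (f 0) (f 1) + σ.onPairs (f 1) (f 2) + σ.onPairs (f 2) (f 0) := by
  rw [finsum_pullback (by decide) (by decide), Fin.sum_univ_three]
  rfl

theorem finsum_pullback_four (σ : Labelling G) (f : cycleGraph 4 ↪g G) :
    ∑ᶠ e : (cycleGraph 4).edgeSet, σ.pullback f e =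
      σ.onPairs (f 0) (f 1) + σ.onPairs (f 1) (f 2) + σ.onPairs (f 2) (f 3) +
        σ.onPairs (f 3) (f 0) := by
  rw [finsum_pullback (by decide) (by decide), Fin.sum_univ_four]
  rfl

theorem finsum_pullback_five (σ : Labelling G) (f : cycleGraph 5 ↪g G) :
    ∑ᶠ e : (cycleGraph 5).edgeSet, σ.pullback f e =
      σ.onPairs (f 0) (f 1) + σ.onPairs (f 1) (f 2) + σ.onPairs (f 2) (f 3) +
        σ.onPairs (f 3) (f 4) + σ.onPairs (f 4) (f 0) := by
  rw [finsum_pullback (by decide) (by decide), Fin.sum_univ_five]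
  rfl

theorem IsAntiEvenBalancing.hasCycleSums {σ : Labelling G} (h : σ.IsAntiEvenBalancing) :
    HasCycleSums G σ.onPairs 1 where
  symm := σ.onPairs_comm
  tri {x y z} h1 h2 h3 := by
    have hf : ∀ i j : Fin 3, G.Adj (![x, y, z] i) (![x, y, z] j) ↔ (cycleGraph 3).Adj i j := by
      intro i j
      fin_cases i <;> fin_cases j <;>
        simp [h1, h2, h3, h1.symm, h2.symm, h3.symm, cycleGraph_adj] <;> decide
    have hinj : Function.Injective ![x, y, z] := by
      intro i j hij
      fin_cases i <;> fin_cases j <;> simp at hij ⊢ <;>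
        first
        | exact h1.ne hij | exact h1.ne' hij | exact h2.ne hij | exact h2.ne' hij
        | exact h3.ne hij | exact h3.ne' hij
    have := h 3 le_rfl ⟨⟨![x, y, z], hinj⟩, hf _ _⟩
    rw [finsum_pullback_three, if_pos rfl] at this
    exact this
  quad {x y z w} h1 h2 h3 h4 n1 n2 k1 k2 := by
    have k1' := mt G.adj_symm k1
    have k2' := mt G.adj_symm k2
    have hf : ∀ i j : Fin 4,
        G.Adj (![x, y, z, w] i) (![x, y, z, w] j) ↔ (cycleGraph 4).Adj i j := by
      intro i j
      fin_cases i <;> fin_cases j <;>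
        simp [h1, h2, h3, h4, h1.symm, h2.symm, h3.symm, h4.symm, k1, k2, k1', k2',
          cycleGraph_adj] <;> decide
    have hinj : Function.Injective ![x, y, z, w] := by
      intro i j hij
      fin_cases i <;> fin_cases j <;> simp at hij ⊢ <;>
        first
        | exact h1.ne hij | exact h1.ne' hij | exact h2.ne hij | exact h2.ne' hij
        | exact h3.ne hij | exact h3.ne' hij | exact h4.ne hij | exact h4.ne' hij
        | exact n1 hij | exact n1.symm hij | exact n2 hij | exact n2.symm hij
    have := h 4 (by norm_num) ⟨⟨![x, y, z, w], hinj⟩, hf _ _⟩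
    rw [finsum_pullback_four, if_neg (by norm_num)] at this
    exact this
  pent {a b c d e} h1 h2 h3 h4 h5 k1 k2 k3 k4 k5 := by
    obtain ⟨f, rfl, rfl, rfl, rfl, rfl⟩ :=
      exists_cycleGraph_five_embedding h1 h2 h3 h4 h5 k1 k2 k3 k4 k5
    have := h 5 (by norm_num) f
    rw [finsum_pullback_five, if_neg (by norm_num)] at this
    exact this

theorem isAntiEvenBalancing_of_hasCycleSums {σ : Labelling G} (hG : NoIndepTriple G)
    (h : HasCycleSums G σ.onPairs 1) : σ.IsAntiEvenBalancing := by
  intro n hn f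
  have adj : ∀ {i j : Fin n}, (cycleGraph n).Adj i j → G.Adj (f i) (f j) := f.map_rel_iff.2
  have nadj : ∀ {i j : Fin n}, ¬ (cycleGraph n).Adj i j → ¬ G.Adj (f i) (f j) :=
    fun h e => h (f.map_rel_iff.1 e)
  have ne : ∀ {i j : Fin n}, i ≠ j → f i ≠ f j := fun h => f.injective.ne h
  obtain rfl | rfl | rfl | h6 : n = 3 ∨ n = 4 ∨ n = 5 ∨ 6 ≤ n := by omega
  · rw [finsum_pullback_three, if_pos rfl]
    exact h.tri (adj (by decide)) (adj (by decide)) (adj (by decide))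
  · rw [finsum_pullback_four, if_neg (by norm_num)]
    exact h.quad (adj (by decide)) (adj (by decide)) (adj (by decide)) (adj (by decide))
      (ne (by decide)) (ne (by decide)) (nadj (by decide)) (nadj (by decide))
  · rw [finsum_pullback_five, if_neg (by norm_num)]
    exact h.pent (adj (by decide)) (adj (by decide)) (adj (by decide)) (adj (by decide))
      (adj (by decide)) (nadj (by decide)) (nadj (by decide)) (nadj (by decide))
      (nadj (by decide)) (nadj (by decide))
  · exfalso
    -- On a cycle of length at least six, the vertices 0, 2, 4 are independent.
    have key : ∀ i j : Fin n, i.val + 2 ≤ j.val → j.val ≤ i.val + 4 →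
        ¬ (cycleGraph n).Adj i j := by
      intro i j h1 h2 hadj
      rw [cycleGraph_adj'] at hadj
      rcases hadj with e | e
      · have hj := j.2
        simp only [Fin.sub_def] at e
        rw [Nat.mod_eq_of_lt (by omega)] at e
        omega
      · rw [Fin.sub_val_of_le (Fin.le_def.2 (by omega))] at e
        omega
    let u : Fin n := ⟨0, by omega⟩
    let v : Fin n := ⟨2, by omega⟩
    let w : Fin n := ⟨4, by omega⟩
    have huv : u ≠ v := by simp [u, v]
    have hvw : v ≠ w := by simp [v, w]
    have hwu : w ≠ u := by simp [u, w]
    rcases hG (f u) (f v) (f w) (ne huv) (ne hvw) (ne hwu) with e | e | e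
    · exact key u v (by simp [u, v]) (by simp [u, v]) (f.map_rel_iff.1 e)
    · exact key v w (by simp [v, w]) (by simp [v, w]) (f.map_rel_iff.1 e)
    · exact key u w (by simp [u, w]) (by simp [u, w]) (f.map_rel_iff.1 e).symm

/-- The labelling with prescribed values at the pairs of adjacent vertices. -/
def ofPairs (G : SimpleGraph V) (l : V → V → ZMod 2) (hl : ∀ x y, l x y = l y x) : Labelling G :=
  fun e => Sym2.lift ⟨l, hl⟩ e.1

theorem onPairs_ofPairs {l : V → V → ZMod 2} (hl : ∀ x y, l x y = l y x) {x y : V}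
    (h : G.Adj x y) : (ofPairs G l hl).onPairs x y = l x y := by
  rw [onPairs_of_adj _ h]
  rfl

end Labelling

/-! ### Circle coordinates and the crossing parity `wrap` -/

namespace CircVertex

/-- The position of a vertex on a circle of length three, cut at `-1`. -/
def pos (x : CircVertex) : ℝ := Complex.arg (x.1 : ℂ) * (3 / (2 * Real.pi))

/-- As `π` is irrational, the point `-1` is not a vertex. Hence positions are continuous and the cut
meets no vertex. -/
theorem arg_lt_pi (x : CircVertex) : Complex.arg (x.1 : ℂ) < Real.pi := by
  refine lt_of_le_of_ne (Complex.arg_le_pi _) fun h => ?_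
  obtain ⟨q, hq⟩ := x.2
  exact irrational_pi ⟨q, by rw [← h, hq]⟩

theorem scale_pos : 0 < 3 / (2 * Real.pi) := by have := Real.pi_pos; positivity

theorem pos_lt (x : CircVertex) : x.pos < 3 / 2 := by
  have := mul_lt_mul_of_pos_right x.arg_lt_pi scale_pos
  have e : Real.pi * (3 / (2 * Real.pi)) = 3 / 2 := by field_simp
  rwa [e] at this

theorem lt_pos (x : CircVertex) : -(3 / 2) < x.pos := by
  have := mul_lt_mul_of_pos_right (Complex.neg_pi_lt_arg (x.1 : ℂ)) scale_pos
  have e : -Real.pi * (3 / (2 * Real.pi)) = -(3 / 2) := by field_simp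
  rwa [e] at this

theorem continuous_pos : Continuous pos := by
  refine Continuous.mul ?_ continuous_const
  rw [continuous_iff_continuousAt]
  intro x
  have h1 : ContinuousAt Complex.arg (x.1 : ℂ) := by
    refine Complex.continuousAt_arg ?_
    rw [Complex.mem_slitPlane_iff_arg]
    exact ⟨x.arg_lt_pi.ne, Circle.coe_ne_zero _⟩
  exact ContinuousAt.comp (f := fun y : CircVertex => (y.1 : ℂ)) h1
    (by fun_prop : Continuous fun y : CircVertex => (y.1 : ℂ)).continuousAt

/-- The vertex with a given rational argument. -/
theorem exists_arg_eq (q : ℚ) (h1 : -Real.pi < q) (h2 : (q : ℝ) < Real.pi) :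
    ∃ x : CircVertex, x.1 = Circle.exp q ∧ Complex.arg (x.1 : ℂ) = q :=
  ⟨⟨Circle.exp q, q, Circle.arg_exp h1 h2.le⟩, rfl, Circle.arg_exp h1 h2.le⟩

theorem exists_pos_mem_Ioo {a b : ℝ} (hab : a < b) (ha : -(3 / 2) ≤ a) (hb : b ≤ 3 / 2) :
    ∃ x : CircVertex, a < x.pos ∧ x.pos < b := by
  have hpi := Real.pi_pos
  have hs := scale_pos
  obtain ⟨q, h1, h2⟩ := exists_rat_btwn (div_lt_div_of_pos_right hab hs)
  have e : 3 / 2 / (3 / (2 * Real.pi)) = Real.pi := by field_simp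
  have e' : -(3 / 2) / (3 / (2 * Real.pi)) = -Real.pi := by field_simp
  have h3 := div_le_div_of_nonneg_right ha hs.le
  have h4 := div_le_div_of_nonneg_right hb hs.le
  rw [e'] at h3
  rw [e] at h4
  obtain ⟨x, -, hx⟩ := exists_arg_eq q (by linarith) (by linarith)
  refine ⟨x, ?_, ?_⟩
  · rw [pos, hx]; exact (div_lt_iff₀ hs).1 h1
  · rw [pos, hx]; exact (lt_div_iff₀ hs).1 h2

theorem abs_pos_sub (x y : CircVertex) :
    |x.pos - y.pos| =
      |Complex.arg (x.1 : ℂ) - Complex.arg (y.1 : ℂ)| * (3 / (2 * Real.pi)) := by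
  rw [pos, pos, ← sub_mul, abs_mul, abs_of_pos scale_pos]

theorem abs_pos_sub_lt (x y : CircVertex) : |x.pos - y.pos| < 3 := by
  have := x.pos_lt
  have := x.lt_pos
  have := y.pos_lt
  have := y.lt_pos
  rw [abs_lt]; constructor <;> linarith

theorem circC3_adj_iff (x y : CircVertex) :
    circC3.Adj x y ↔ 1 < |x.pos - y.pos| ∧ |x.pos - y.pos| < 2 := by
  have hpi := Real.pi_pos
  change 2 / 3 * Real.pi < |Complex.arg ((x.1 : ℂ) / (y.1 : ℂ))| ↔ _
  have h := Complex.arg_div_coe_angle (Circle.coe_ne_zero x.1) (Circle.coe_ne_zero y.1)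
  rw [← Real.Angle.coe_sub, Real.Angle.angle_eq_iff_two_pi_dvd_sub] at h
  obtain ⟨k, hk⟩ := h
  have c1 := Complex.neg_pi_lt_arg ((x.1 : ℂ) / (y.1 : ℂ))
  have c2 := Complex.arg_le_pi ((x.1 : ℂ) / (y.1 : ℂ))
  have a1 := Complex.neg_pi_lt_arg (x.1 : ℂ)
  have a2 := x.arg_lt_pi
  have b1 := Complex.neg_pi_lt_arg (y.1 : ℂ)
  have b2 := y.arg_lt_pi
  rw [abs_pos_sub]
  have a3 : -(2 * Real.pi) < Complex.arg (x.1 : ℂ) - Complex.arg (y.1 : ℂ) := by linarith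
  have a4 : Complex.arg (x.1 : ℂ) - Complex.arg (y.1 : ℂ) < 2 * Real.pi := by linarith
  generalize Complex.arg ((x.1 : ℂ) / (y.1 : ℂ)) = C at *
  generalize Complex.arg (x.1 : ℂ) - Complex.arg (y.1 : ℂ) = D at *
  have e1 : 1 < |D| * (3 / (2 * Real.pi)) ↔ 2 / 3 * Real.pi < |D| := by
    rw [← mul_div_assoc, lt_div_iff₀ (by positivity)]
    constructor <;> intro h <;> linarith
  have e2 : |D| * (3 / (2 * Real.pi)) < 2 ↔ |D| < 4 / 3 * Real.pi := by
    rw [← mul_div_assoc, div_lt_iff₀ (by positivity)]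
    constructor <;> intro h <;> linarith
  rw [e1, e2]
  have k1 : (-2 : ℝ) < k := by
    by_contra h
    push Not at h
    have := mul_le_mul_of_nonneg_left h hpi.le
    linarith
  have k2 : (k : ℝ) < 2 := by
    by_contra h
    push Not at h
    have := mul_le_mul_of_nonneg_left h hpi.le
    linarith
  have k1' : -2 < k := by exact_mod_cast k1
  have k2' : k < 2 := by exact_mod_cast k2
  -- The argument of the quotient is the difference of arguments up to `2πk`; both ranges are
  -- bounded, which leaves these three `k`.
  obtain rfl | rfl | rfl : k = -1 ∨ k = 0 ∨ k = 1 := by omega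
  all_goals
    push_cast at hk
    rcases abs_cases C with ⟨h1, h1'⟩ | ⟨h1, h1'⟩ <;>
    rcases abs_cases D with ⟨h2, h2'⟩ | ⟨h2, h2'⟩ <;> rw [h1, h2] <;>
    constructor <;> intro h <;> first | (constructor <;> linarith) | linarith

/-- The distance is a rational multiple of `1 / π`. This is what makes the inequalities for
adjacency in the complement strict. -/
theorem abs_pos_sub_ne {n : ℕ} (hn : n ≠ 0) (x y : CircVertex) : |x.pos - y.pos| ≠ n := by
  intro h
  rw [abs_pos_sub] at h
  obtain ⟨q, hq⟩ := x.2
  obtain ⟨r, hr⟩ := y.2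
  rw [hq, hr] at h
  have hn' : (n : ℝ) ≠ 0 := by exact_mod_cast hn
  refine irrational_pi ⟨|q - r| * 3 / (2 * n), ?_⟩
  have := Real.pi_pos
  push_cast
  field_simp at h ⊢
  linarith

theorem coC3_adj_iff (x y : CircVertex) :
    coC3.Adj x y ↔ x ≠ y ∧ (|x.pos - y.pos| < 1 ∨ 2 < |x.pos - y.pos|) := by
  rw [compl_adj, circC3_adj_iff]
  have h1 := abs_pos_sub_ne one_ne_zero x y
  have h2 := abs_pos_sub_ne two_ne_zero x y
  push_cast at h1 h2
  refine and_congr_right fun _ => ?_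
  rw [not_and_or, not_lt, not_lt]
  exact or_congr ⟨fun h => lt_of_le_of_ne h h1, le_of_lt⟩
    ⟨fun h => lt_of_le_of_ne h h2.symm, le_of_lt⟩

theorem abs_pos_sub_mem_of_not_adj {x y : CircVertex} (hxy : x ≠ y) (h : ¬ coC3.Adj x y) :
    1 < |x.pos - y.pos| ∧ |x.pos - y.pos| < 2 := by
  rw [compl_adj, not_and, not_not] at h
  exact (circC3_adj_iff x y).1 (h hxy)

/-- Three numbers with sum zero cannot all have absolute value strictly between 1 and 2: two have
the same sign, and the third would exceed 2 in absolute value. -/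
theorem noIndepTriple_coC3 : NoIndepTriple coC3 := by
  intro x y z hxy hyz hzx
  by_contra hc
  push Not at hc
  obtain ⟨h1, h2, h3⟩ := hc
  have a1 := abs_pos_sub_mem_of_not_adj hxy h1
  have a2 := abs_pos_sub_mem_of_not_adj hyz h2
  have a3 := abs_pos_sub_mem_of_not_adj hzx h3
  rcases abs_cases (x.pos - y.pos) with ⟨e1, _⟩ | ⟨e1, _⟩ <;>
  rcases abs_cases (y.pos - z.pos) with ⟨e2, _⟩ | ⟨e2, _⟩ <;>
  rcases abs_cases (z.pos - x.pos) with ⟨e3, _⟩ | ⟨e3, _⟩ <;>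
  rw [e1] at a1 <;> rw [e2] at a2 <;> rw [e3] at a3 <;> linarith

/-- The parity of the crossings of the shorter arc between two vertices with the point `-1`. -/
def wrap (x y : CircVertex) : ZMod 2 := if 3 / 2 < |x.pos - y.pos| then 1 else 0

theorem wrap_comm (x y : CircVertex) : wrap x y = wrap y x := by
  rw [wrap, wrap, abs_sub_comm]

/-- The integer `m` counts signed crossings of the cut, so `y.pos - x.pos - 3 * m` is the
displacement along the short arc, lifted to the line. -/
theorem exists_winding {x y : CircVertex} (h : coC3.Adj x y) :
    ∃ m : ℤ, |y.pos - x.pos - 3 * m| < 1 ∧ wrap x y = m := by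
  have h1 := ((coC3_adj_iff x y).1 h).2
  have h2 := abs_pos_sub_lt x y
  rcases abs_cases (x.pos - y.pos) with ⟨e, e'⟩ | ⟨e, e'⟩ <;> rw [wrap, e] <;>
    rw [e] at h1 h2 <;> rcases h1 with h1 | h1
  · refine ⟨0, ?_, ?_⟩
    · rw [abs_lt]; push_cast; constructor <;> linarith
    · rw [if_neg (by linarith)]; rfl
  · refine ⟨-1, ?_, ?_⟩
    · rw [abs_lt]; push_cast; constructor <;> linarith
    · rw [if_pos (by linarith)]; rfl
  · refine ⟨0, ?_, ?_⟩
    · rw [abs_lt]; push_cast; constructor <;> linarith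
    · rw [if_neg (by linarith)]; rfl
  · refine ⟨1, ?_, ?_⟩
    · rw [abs_lt]; push_cast; constructor <;> linarith
    · rw [if_pos (by linarith)]; rfl

theorem one_lt_of_not_adj {x y : CircVertex} (hxy : x ≠ y) (h : ¬ coC3.Adj x y) (m : ℤ) :
    1 < y.pos - x.pos - 3 * m ∨ y.pos - x.pos - 3 * m < -1 := by
  obtain ⟨h1, h2⟩ := abs_pos_sub_mem_of_not_adj hxy h
  rw [abs_lt] at h2
  obtain hm | rfl | hm : m ≤ -1 ∨ m = 0 ∨ 1 ≤ m := by omega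
  · have : (m : ℝ) ≤ -1 := by exact_mod_cast hm
    left; linarith
  · rcases lt_abs.1 h1 with h1 | h1
    · right; push_cast; linarith
    · left; push_cast; linarith
  · have : (1 : ℝ) ≤ m := by exact_mod_cast hm
    right; linarith

theorem intCast_eq_one_of_abs_lt {k : ℤ} (h0 : k ≠ 0) (h1 : (-2 : ℝ) < k) (h2 : (k : ℝ) < 2) :
    (k : ZMod 2) = 1 := by
  have h1' : -2 < k := by exact_mod_cast h1
  have h2' : k < 2 := by exact_mod_cast h2
  obtain rfl | rfl : k = 1 ∨ k = -1 := by omega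
  all_goals rfl

/-- Lifted displacements along a closed walk add up to `-3` times the total of the `m`'s. Each is
shorter than 1, so the total is 0 for a triangle and at most 1 in absolute value for four or five
steps. On a longer induced cycle two consecutive steps cover more than 1, so they have the same
sign; hence all steps do, and the total is not 0. -/
theorem hasCycleSums_wrap : HasCycleSums coC3 wrap 1 where
  symm := wrap_comm
  tri {x y z} h1 h2 h3 := by
    obtain ⟨m₁, b1, w1⟩ := exists_winding h1
    obtain ⟨m₂, b2, w2⟩ := exists_winding h2
    obtain ⟨m₃, b3, w3⟩ := exists_winding h3
    rw [abs_lt] at b1 b2 b3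
    have k1 : ((m₁ + m₂ + m₃ : ℤ) : ℝ) < 1 := by push_cast; linarith
    have k2 : (-1 : ℝ) < (m₁ + m₂ + m₃ : ℤ) := by push_cast; linarith
    have k1' : m₁ + m₂ + m₃ < 1 := by exact_mod_cast k1
    have k2' : -1 < m₁ + m₂ + m₃ := by exact_mod_cast k2
    have : m₁ + m₂ + m₃ = 0 := by omega
    rw [w1, w2, w3]
    exact_mod_cast congrArg (Int.cast : ℤ → ZMod 2) this
  quad {x y z w} h1 h2 h3 h4 n1 n2 g1 g2 := by
    obtain ⟨m₁, b1, w1⟩ := exists_winding h1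
    obtain ⟨m₂, b2, w2⟩ := exists_winding h2
    obtain ⟨m₃, b3, w3⟩ := exists_winding h3
    obtain ⟨m₄, b4, w4⟩ := exists_winding h4
    rw [abs_lt] at b1 b2 b3 b4
    have q1 := one_lt_of_not_adj n1 g1 (m₁ + m₂)
    have q2 := one_lt_of_not_adj n2 g2 (m₂ + m₃)
    have q3 := one_lt_of_not_adj n1.symm (mt coC3.adj_symm g1) (m₃ + m₄)
    push_cast at q1 q2 q3
    rw [w1, w2, w3, w4]
    have key : ((m₁ + m₂ + m₃ + m₄ : ℤ) : ZMod 2) = 1 := by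
      refine intCast_eq_one_of_abs_lt (fun h0 => ?_) ?_ ?_
      · have h0' : (m₁ + m₂ + m₃ + m₄ : ℝ) = 0 := by exact_mod_cast h0
        rcases q1 with q1 | q1 <;> rcases q2 with q2 | q2 <;> rcases q3 with q3 | q3 <;> linarith
      · push_cast; linarith
      · push_cast; linarith
    exact_mod_cast key
  pent {a b c d e} h1 h2 h3 h4 h5 g1 g2 g3 g4 g5 := by
    have n1 : a ≠ c := by rintro rfl; exact g4 h3.symm
    have n2 : b ≠ d := by rintro rfl; exact g5 h4.symm
    have n3 : c ≠ e := by rintro rfl; exact g1 h5.symm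
    have n4 : d ≠ a := by rintro rfl; exact g2 h1.symm
    obtain ⟨m₁, b1, w1⟩ := exists_winding h1
    obtain ⟨m₂, b2, w2⟩ := exists_winding h2
    obtain ⟨m₃, b3, w3⟩ := exists_winding h3
    obtain ⟨m₄, b4, w4⟩ := exists_winding h4
    obtain ⟨m₅, b5, w5⟩ := exists_winding h5
    rw [abs_lt] at b1 b2 b3 b4 b5
    have q1 := one_lt_of_not_adj n1 g1 (m₁ + m₂)
    have q2 := one_lt_of_not_adj n2 g2 (m₂ + m₃)
    have q3 := one_lt_of_not_adj n3 g3 (m₃ + m₄)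
    have q4 := one_lt_of_not_adj n4 g4 (m₄ + m₅)
    push_cast at q1 q2 q3 q4
    rw [w1, w2, w3, w4, w5]
    have key : ((m₁ + m₂ + m₃ + m₄ + m₅ : ℤ) : ZMod 2) = 1 := by
      refine intCast_eq_one_of_abs_lt (fun h0 => ?_) ?_ ?_
      · have h0' : (m₁ + m₂ + m₃ + m₄ + m₅ : ℝ) = 0 := by exact_mod_cast h0
        rcases q1 with q1 | q1 <;> rcases q2 with q2 | q2 <;> rcases q3 with q3 | q3 <;>
          rcases q4 with q4 | q4 <;> linarith
      · push_cast; linarith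
      · push_cast; linarith
    exact_mod_cast key

end CircVertex

/-! ### A dense partition, a five-cycle and density in arcs -/

theorem exists_rat_odd_den_btwn {a b : ℝ} (hab : a < b) :
    ∃ q : ℚ, a < q ∧ (q : ℝ) < b ∧ Odd q.den := by
  obtain ⟨k, hk⟩ := exists_pow_lt_of_lt_one (sub_pos.2 hab) (by norm_num : (1 / 3 : ℝ) < 1)
  have h3 : (0 : ℝ) < 3 ^ k := by positivity
  have hk' : 1 < (b - a) * 3 ^ k := by
    rw [div_pow, one_pow, div_lt_iff₀ h3] at hk
    exact hk
  refine ⟨((⌊a * 3 ^ k⌋ + 1 : ℤ) : ℚ) / ((3 ^ k : ℤ) : ℚ), ?_, ?_, ?_⟩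
  · push_cast
    rw [lt_div_iff₀ h3]
    exact Int.lt_floor_add_one _
  · push_cast
    rw [div_lt_iff₀ h3]
    linarith [Int.floor_le (a * 3 ^ k)]
  · have h := Rat.den_dvd (⌊a * 3 ^ k⌋ + 1) (3 ^ k)
    have h' : (((⌊a * 3 ^ k⌋ + 1 : ℤ) : ℚ) / ((3 ^ k : ℤ) : ℚ)).den ∣ 3 ^ k := by
      rw [← Rat.divInt_eq_div]
      exact_mod_cast h
    exact Odd.of_dvd_nat (Odd.pow (by decide)) h'

theorem exists_rat_even_den_btwn {a b : ℝ} (hab : a < b) :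
    ∃ q : ℚ, a < q ∧ (q : ℝ) < b ∧ Even q.den := by
  obtain ⟨k, hk⟩ := exists_pow_lt_of_lt_one (half_pos (sub_pos.2 hab))
    (by norm_num : (1 / 2 : ℝ) < 1)
  have h2 : (0 : ℝ) < 2 ^ k := by positivity
  have h2' : (0 : ℝ) < 2 ^ (k + 1) := by positivity
  have hk' : 2 < (b - a) * 2 ^ k := by
    rw [div_pow, one_pow, div_lt_iff₀ h2] at hk
    linarith
  set m := ⌊a * 2 ^ k⌋ with hm
  have m1 : (m : ℝ) ≤ a * 2 ^ k := Int.floor_le _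
  have m2 : a * 2 ^ k < m + 1 := Int.lt_floor_add_one _
  -- An odd numerator keeps the power of two in the reduced denominator.
  refine ⟨((2 * (m + 1) + 1 : ℤ) : ℚ) / ((2 ^ (k + 1) : ℤ) : ℚ), ?_, ?_, ?_⟩
  · push_cast
    rw [lt_div_iff₀ h2', pow_succ]
    linarith
  · push_cast
    rw [div_lt_iff₀ h2', pow_succ]
    linarith
  · have hc : Nat.Coprime (2 * (m + 1) + 1).natAbs (2 ^ (k + 1) : ℤ).natAbs := by
      rw [Int.natAbs_pow]
      refine Nat.Coprime.pow_right _ ?_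
      change Nat.Coprime _ 2
      rw [Nat.coprime_two_right, Int.natAbs_odd]
      exact ⟨m + 1, rfl⟩
    have h := Rat.den_div_eq_of_coprime (by positivity : (0 : ℤ) < 2 ^ (k + 1)) hc
    have h' : (((2 * (m + 1) + 1 : ℤ) : ℚ) / ((2 ^ (k + 1) : ℤ) : ℚ)).den = 2 ^ (k + 1) := by
      exact_mod_cast h
    rw [h', pow_succ]
    exact even_two.mul_left _

namespace CircVertex

open Classical in
/-- The parity of the denominator of the argument. -/
def denParity (x : CircVertex) : ZMod 2 :=
  if ∃ q : ℚ, Complex.arg (x.1 : ℂ) = q ∧ Even q.den then 1 else 0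

theorem denParity_eq {x : CircVertex} {q : ℚ} (hq : Complex.arg (x.1 : ℂ) = q) :
    x.denParity = if Even q.den then 1 else 0 := by
  have : (∃ r : ℚ, Complex.arg (x.1 : ℂ) = r ∧ Even r.den) ↔ Even q.den := by
    constructor
    · rintro ⟨r, hr, h⟩
      have : r = q := by exact_mod_cast hr.symm.trans hq
      rwa [← this]
    · exact fun h => ⟨q, hq, h⟩
  rw [denParity]
  simp only [this]

theorem dense_of_forall_rat {S : Set CircVertex}
    (h : ∀ a b : ℝ, a < b → ∃ q : ℚ, a < q ∧ (q : ℝ) < b ∧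
      ∀ x : CircVertex, Complex.arg (x.1 : ℂ) = q → x ∈ S) : Dense S := by
  rw [dense_iff_inter_open]
  rintro U hU ⟨x, hx⟩
  obtain ⟨U', hU', rfl⟩ := isOpen_induced_iff.1 hU
  have hO : IsOpen (Circle.exp ⁻¹' U' ∩ Set.Ioo (-Real.pi) Real.pi) :=
    (hU'.preimage Circle.exp.continuous).inter isOpen_Ioo
  have hmem : Complex.arg (x.1 : ℂ) ∈ Circle.exp ⁻¹' U' ∩ Set.Ioo (-Real.pi) Real.pi := by
    refine ⟨?_, Complex.neg_pi_lt_arg _, x.arg_lt_pi⟩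
    rw [Set.mem_preimage, Circle.exp_arg]
    exact hx
  obtain ⟨a, b, hab, hsub⟩ := mem_nhds_iff_exists_Ioo_subset.1 (hO.mem_nhds hmem)
  obtain ⟨q, h1, h2, hS⟩ := h a b (hab.1.trans hab.2)
  obtain ⟨hqU, hq1, hq2⟩ := hsub ⟨h1, h2⟩
  obtain ⟨y, hy, hy'⟩ := exists_arg_eq q hq1 hq2
  refine ⟨y, ?_, hS y hy'⟩
  rw [Set.mem_preimage, hy]
  exact hqU

theorem isDensePartition_denParity : IsDensePartition denParity := by
  constructor
  · refine dense_of_forall_rat fun a b hab => ?_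
    obtain ⟨q, h1, h2, h3⟩ := exists_rat_odd_den_btwn hab
    refine ⟨q, h1, h2, fun x hx => ?_⟩
    rw [Set.mem_ofPred_eq, denParity_eq hx, if_neg (Nat.not_even_iff_odd.2 h3)]
  · refine dense_of_forall_rat fun a b hab => ?_
    obtain ⟨q, h1, h2, h3⟩ := exists_rat_even_den_btwn hab
    refine ⟨q, h1, h2, fun x hx => ?_⟩
    rw [Set.mem_ofPred_eq, denParity_eq hx, if_pos h3]

theorem nonempty_cycleGraph_five_embedding : Nonempty (cycleGraph 5 ↪g coC3) := by
  have adj : ∀ {x y : CircVertex}, 0 < |x.pos - y.pos| →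
      (|x.pos - y.pos| < 1 ∨ 2 < |x.pos - y.pos|) → coC3.Adj x y := by
    intro x y h h'
    refine (coC3_adj_iff x y).2 ⟨?_, h'⟩
    rintro rfl
    simp at h
  have nadj : ∀ {x y : CircVertex}, 1 < |x.pos - y.pos| → |x.pos - y.pos| < 2 →
      ¬ coC3.Adj x y := by
    intro x y h h' hxy
    rcases ((coC3_adj_iff x y).1 hxy).2 with e | e <;> linarith
  -- Five points at spacing about `3/5`: consecutive ones are closer than 1, the closing pair is
  -- more than 2 apart in position, and the tolerance `1/20` preserves all inequalities.
  have pt : ∀ t : ℝ, -(13 / 10) ≤ t → t ≤ 13 / 10 →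
      ∃ x : CircVertex, t - 1 / 20 < x.pos ∧ x.pos < t + 1 / 20 := fun t h1 h2 =>
    exists_pos_mem_Ioo (by linarith) (by linarith) (by linarith)
  obtain ⟨a, a1, a2⟩ := pt (-6 / 5) (by norm_num) (by norm_num)
  obtain ⟨b, b1, b2⟩ := pt (-3 / 5) (by norm_num) (by norm_num)
  obtain ⟨c, c1, c2⟩ := pt 0 (by norm_num) (by norm_num)
  obtain ⟨d, d1, d2⟩ := pt (3 / 5) (by norm_num) (by norm_num)
  obtain ⟨e, e1, e2⟩ := pt (6 / 5) (by norm_num) (by norm_num)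
  have near : ∀ {x y : CircVertex}, x.pos < y.pos → y.pos - x.pos < 1 → coC3.Adj x y := by
    intro x y h h'
    have : |x.pos - y.pos| = y.pos - x.pos := by rw [abs_sub_comm, abs_of_pos (by linarith)]
    exact adj (by rw [this]; linarith) (Or.inl (by rw [this]; linarith))
  have far : ∀ {x y : CircVertex}, 1 < y.pos - x.pos → y.pos - x.pos < 2 → ¬ coC3.Adj x y := by
    intro x y h h'
    have : |x.pos - y.pos| = y.pos - x.pos := by rw [abs_sub_comm, abs_of_pos (by linarith)]
    exact nadj (by rw [this]; linarith) (by rw [this]; linarith)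
  have hea : coC3.Adj e a := by
    have : |e.pos - a.pos| = e.pos - a.pos := abs_of_pos (by linarith)
    exact adj (by rw [this]; linarith) (Or.inr (by rw [this]; linarith))
  obtain ⟨f, -⟩ := exists_cycleGraph_five_embedding (a := a) (b := b) (c := c) (d := d) (e := e)
    (near (by linarith) (by linarith)) (near (by linarith) (by linarith))
    (near (by linarith) (by linarith)) (near (by linarith) (by linarith)) hea
    (far (by linarith) (by linarith)) (far (by linarith) (by linarith))
    (far (by linarith) (by linarith))
    (mt coC3.adj_symm (far (by linarith) (by linarith)))
    (mt coC3.adj_symm (far (by linarith) (by linarith)))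
  exact ⟨f⟩

theorem exists_mem_Ioo_of_dense {S : Set CircVertex} (hS : Dense S) {a b : ℝ} (hab : a < b)
    (ha : -(3 / 2) ≤ a) (hb : b ≤ 3 / 2) : ∃ x ∈ S, a < pos x ∧ pos x < b := by
  obtain ⟨x, hx⟩ := exists_pos_mem_Ioo hab ha hb
  obtain ⟨y, hy, hy'⟩ := hS.inter_open_nonempty _ (isOpen_Ioo.preimage continuous_pos) ⟨x, hx⟩
  exact ⟨y, hy', hy⟩

open Filter Topology in
/-- A function that differs from the index of a dense partition by a function that is constant
between finitely many positions takes all values in every arc. -/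
theorem exists_add_eq_of_isDensePartition {i h : CircVertex → ZMod 2} (hi : IsDensePartition i)
    {B : Set ℝ} (hB : B.Finite)
    (hh : ∀ x y : CircVertex, (∀ t ∈ B, x.pos ≠ t ∧ y.pos ≠ t ∧ (x.pos < t ↔ y.pos < t)) →
      h x = h y)
    {a b : ℝ} (hab : a < b) (ha : -(3 / 2) ≤ a) (hb : b ≤ 3 / 2) (s : ZMod 2) :
    ∃ x : CircVertex, a < x.pos ∧ x.pos < b ∧ (∀ t ∈ B, x.pos ≠ t) ∧ i x + h x = s := by
  obtain ⟨u, ⟨hu1, hu2⟩, huB⟩ := ((Set.Ioo_infinite hab).sdiff hB).nonempty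
  have hev : ∀ᶠ y in 𝓝 u, (a < y ∧ y < b) ∧ ∀ t ∈ B, y ≠ t ∧ (y < t ↔ u < t) := by
    refine (eventually_mem_set.2 (Ioo_mem_nhds hu1 hu2)).and
      ((eventually_all_finite hB).2 fun t ht => ?_)
    have hut : u ≠ t := fun e => huB (e ▸ ht)
    rcases lt_or_gt_of_ne hut with e | e
    · filter_upwards [Iio_mem_nhds e] with y hy
      exact ⟨ne_of_lt hy, iff_of_true hy e⟩
    · filter_upwards [Ioi_mem_nhds e] with y hy
      exact ⟨ne_of_gt hy, iff_of_false (lt_asymm hy) (lt_asymm e)⟩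
  obtain ⟨a', b', hu', hsub⟩ := mem_nhds_iff_exists_Ioo_subset.1 hev
  have hab' : max a a' < min b b' := by
    rw [max_lt_iff, lt_min_iff, lt_min_iff]
    exact ⟨⟨hab, hu1.trans hu'.2⟩, hu'.1.trans hu2, hu'.1.trans hu'.2⟩
  have ha' : -(3 / 2) ≤ max a a' := le_max_of_le_left ha
  have hb' : min b b' ≤ 3 / 2 := min_le_of_left_le hb
  obtain ⟨x, hx, hx1, hx2⟩ := exists_mem_Ioo_of_dense hi.1 hab' ha' hb'
  obtain ⟨y, hy, hy1, hy2⟩ := exists_mem_Ioo_of_dense hi.2 hab' ha' hb'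
  rw [Set.mem_ofPred_eq] at hx hy
  have qx := hsub ⟨(le_max_right a a').trans_lt hx1, hx2.trans_le (min_le_right b b')⟩
  have qy := hsub ⟨(le_max_right a a').trans_lt hy1, hy2.trans_le (min_le_right b b')⟩
  have hxy : h x = h y := hh x y fun t ht =>
    ⟨(qx.2 t ht).1, (qy.2 t ht).1, (qx.2 t ht).2.trans (qy.2 t ht).2.symm⟩
  -- `x` and `y` have different indices but the same value of `h`, so one of them attains `s`.
  have h01 : h x = s ∨ 1 + h x = s := by
    generalize h x = v
    revert v s
    decide
  rcases h01 with e | e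
  · exact ⟨x, qx.1.1, qx.1.2, fun t ht => (qx.2 t ht).1, by rw [hx, zero_add, e]⟩
  · exact ⟨y, qy.1.1, qy.1.2, fun t ht => (qy.2 t ht).1, by rw [hy, ← hxy, e]⟩

theorem coC3_adj_of_near {x y : CircVertex} (hxy : x ≠ y) (h1 : -1 < y.pos - x.pos)
    (h2 : y.pos - x.pos < 1) : coC3.Adj x y ∧ wrap x y = 0 := by
  have h : |x.pos - y.pos| < 1 := by rw [abs_lt]; constructor <;> linarith
  exact ⟨(coC3_adj_iff x y).2 ⟨hxy, Or.inl h⟩, if_neg (by linarith)⟩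

theorem not_coC3_adj {x y : CircVertex} (h1 : 1 < y.pos - x.pos) (h2 : y.pos - x.pos < 2) :
    ¬ coC3.Adj x y := by
  have h : |x.pos - y.pos| = y.pos - x.pos := by rw [abs_sub_comm, abs_of_pos (by linarith)]
  rw [coC3_adj_iff, h]
  rintro ⟨-, e | e⟩ <;> linarith

theorem coC3_adj_of_far {x y : CircVertex} (h1 : 2 < y.pos - x.pos) :
    coC3.Adj x y ∧ wrap x y = 1 := by
  have h : |x.pos - y.pos| = y.pos - x.pos := by rw [abs_sub_comm, abs_of_pos (by linarith)]
  refine ⟨(coC3_adj_iff x y).2 ⟨?_, Or.inr (by rwa [h])⟩, if_pos (by rw [h]; linarith)⟩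
  rintro rfl
  linarith

end CircVertex

namespace CircVertex

/-! ### The spanning tree and the labelling it determines -/

section Tree

variable (p : cycleGraph 5 ↪g coC3)

theorem adj_cycle {j k : Fin 5} (h : (cycleGraph 5).Adj j k) : coC3.Adj (p j) (p k) :=
  p.map_rel_iff.2 h

theorem not_adj_cycle {j k : Fin 5} (h : ¬ (cycleGraph 5).Adj j k) : ¬ coC3.Adj (p j) (p k) :=
  fun e => h (p.map_rel_iff.1 e)

/-- `p 0` and `p 2` are not adjacent, so every other vertex is adjacent to one of them, and both are
adjacent to `p 1`. Hence only `p 0`, `p 1`, `p 2` occur as parents. -/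
theorem exists_le_two_adj (x : CircVertex) : ∃ k : Fin 5, k ≤ 2 ∧ coC3.Adj x (p k) := by
  by_cases h0 : x = p 0
  · exact ⟨1, by decide, h0 ▸ adj_cycle p (by decide)⟩
  by_cases h2 : x = p 2
  · exact ⟨1, by decide, h2 ▸ adj_cycle p (by decide)⟩
  rcases noIndepTriple_coC3 x (p 0) (p 2) h0 (p.injective.ne (by decide)) (Ne.symm h2)
    with e | e | e
  · exact ⟨0, by decide, e⟩
  · exact absurd e (not_adj_cycle p (by decide))
  · exact ⟨2, by decide, e.symm⟩

theorem exists_isFirstNeighbour (x : CircVertex) : ∃ k, IsFirstNeighbour p x k := by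
  obtain ⟨k, -, hk⟩ := exists_le_two_adj p x
  obtain ⟨m, hm, hmin⟩ := WellFounded.has_min (wellFounded_lt (α := Fin 5))
    {k | coC3.Adj x (p k)} ⟨k, hk⟩
  exact ⟨m, hm, fun j hj hx => hmin j hx hj⟩

variable {p} in
theorem IsFirstNeighbour.unique {x : CircVertex} {j k : Fin 5} (hj : IsFirstNeighbour p x j)
    (hk : IsFirstNeighbour p x k) : j = k := by
  rcases lt_trichotomy j k with h | h | h
  · exact absurd hj.1 (hk.2 j h)
  · exact h
  · exact absurd hk.1 (hj.2 k h)

/-- The index `k` with `p_x = pᵏ`. -/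
def firstIndex (x : CircVertex) : Fin 5 := (exists_isFirstNeighbour p x).choose

theorem isFirstNeighbour_firstIndex (x : CircVertex) : IsFirstNeighbour p x (firstIndex p x) :=
  (exists_isFirstNeighbour p x).choose_spec

variable {p} in
theorem IsFirstNeighbour.firstIndex_eq {x : CircVertex} {k : Fin 5}
    (h : IsFirstNeighbour p x k) : firstIndex p x = k :=
  IsFirstNeighbour.unique (isFirstNeighbour_firstIndex p x) h

theorem firstIndex_le_two (x : CircVertex) : firstIndex p x ≤ 2 := by
  obtain ⟨k, hk, hx⟩ := exists_le_two_adj p x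
  by_contra h
  exact (isFirstNeighbour_firstIndex p x).2 k (hk.trans_lt (not_le.1 h)) hx

theorem firstIndex_cases (x : CircVertex) :
    firstIndex p x = 0 ∨ firstIndex p x = 1 ∨ firstIndex p x = 2 := by
  have := firstIndex_le_two p x
  revert this
  generalize firstIndex p x = k
  revert k
  decide

theorem firstIndex_one : firstIndex p (p 1) = 0 :=
  IsFirstNeighbour.firstIndex_eq ⟨adj_cycle p (by decide),
    fun j hj => absurd hj (Fin.not_lt_zero j)⟩

theorem firstIndex_two : firstIndex p (p 2) = 1 := by
  refine IsFirstNeighbour.firstIndex_eq ⟨adj_cycle p (by decide), fun j hj => ?_⟩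
  have : j = 0 := by revert j; decide
  rw [this]
  exact not_adj_cycle p (by decide)

theorem firstNeighbourTree_adj (x y : CircVertex) : (firstNeighbourTree p).Adj x y ↔
    (x ≠ p 0 ∧ y = p (firstIndex p x)) ∨ (y ≠ p 0 ∧ x = p (firstIndex p y)) := by
  have hrel : ∀ u v, (∃ k, IsFirstNeighbour p u k ∧ v = p k) ↔ v = p (firstIndex p u) := by
    intro u v
    constructor
    · rintro ⟨k, hk, rfl⟩
      rw [IsFirstNeighbour.firstIndex_eq hk]
    · exact fun h => ⟨_, isFirstNeighbour_firstIndex p u, h⟩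
  have hne : ∀ u, u ≠ p (firstIndex p u) := fun u => (isFirstNeighbour_firstIndex p u).1.ne
  have h0 : firstIndex p (p 0) = 1 := by
    refine IsFirstNeighbour.firstIndex_eq ⟨adj_cycle p (by decide), fun j hj => ?_⟩
    have : j = 0 := by revert j; decide
    rw [this]
    exact coC3.loopless.irrefl _
  have h01 : p 0 ≠ p 1 := p.injective.ne (by decide)
  rw [firstNeighbourTree, fromRel_adj, hrel, hrel]
  constructor
  · rintro ⟨-, e | e⟩
    · by_cases hx : x = p 0
      · right
        subst hx
        rw [h0] at e
        subst e
        exact ⟨h01.symm, by rw [firstIndex_one]⟩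
      · exact Or.inl ⟨hx, e⟩
    · by_cases hy : y = p 0
      · left
        subst hy
        rw [h0] at e
        subst e
        exact ⟨h01.symm, by rw [firstIndex_one]⟩
      · exact Or.inr ⟨hy, e⟩
  · rintro (⟨-, e⟩ | ⟨-, e⟩)
    · exact ⟨fun h => hne x (h.trans e), Or.inl e⟩
    · exact ⟨fun h => hne y (h.symm.trans e), Or.inr e⟩

theorem firstNeighbourTree_le : firstNeighbourTree p ≤ coC3 := by
  intro x y h
  rcases (firstNeighbourTree_adj p x y).1 h with ⟨-, rfl⟩ | ⟨-, rfl⟩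
  · exact (isFirstNeighbour_firstIndex p x).1
  · exact (isFirstNeighbour_firstIndex p y).1.symm

open Classical in
theorem isTree_firstNeighbourTree : (firstNeighbourTree p).IsTree := by
  have h10 : p 1 ≠ p 0 := p.injective.ne (by decide)
  have h20 : p 2 ≠ p 0 := p.injective.ne (by decide)
  have h21 : p 2 ≠ p 1 := p.injective.ne (by decide)
  -- The parents of `p 2` and `p 1` are `p 1` and `p 0`; every other vertex except the root has one
  -- of these three as its parent.
  refine isTree_of_parent (p 0) (fun x => p (firstIndex p x))
    (fun x => if x = p 0 then 0 else if x = p 1 then 1 else if x = p 2 then 2 else 3)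
    (fun x hx => ?_) (firstNeighbourTree_adj p)
  by_cases h1 : x = p 1
  · subst h1
    simp [firstIndex_one, h10]
  by_cases h2 : x = p 2
  · subst h2
    simp [firstIndex_two, h10, h20, h21]
  rcases firstIndex_cases p x with e | e | e <;> simp [e, hx, h1, h2, h10, h20, h21]

variable (i : CircVertex → ZMod 2)

/-- The value at `pᵏ`, for `k ≤ 2`, of the potential prescribed by the tree labels. -/
def cyclePotential : Fin 5 → ZMod 2 :=
  ![0, i (p 1) + wrap (p 1) (p 0),
    i (p 2) + (i (p 1) + wrap (p 1) (p 0) + wrap (p 2) (p 1)), 0, 0]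

/-- The part of the potential that is locally constant off finitely many vertices. -/
def stepPotential (x : CircVertex) : ZMod 2 :=
  cyclePotential p i (firstIndex p x) + wrap x (p (firstIndex p x))

open Classical in
/-- The potential by which the labelling with the prescribed tree labels differs from `wrap`. -/
def treePotential (x : CircVertex) : ZMod 2 := if x = p 0 then 0 else i x + stepPotential p i x

theorem treePotential_firstIndex (x : CircVertex) :
    treePotential p i (p (firstIndex p x)) = cyclePotential p i (firstIndex p x) := by
  have h10 : p 1 ≠ p 0 := p.injective.ne (by decide)
  have h20 : p 2 ≠ p 0 := p.injective.ne (by decide)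
  rcases firstIndex_cases p x with e | e | e <;> rw [e]
  · rw [treePotential, if_pos rfl]
    rfl
  · rw [treePotential, if_neg h10, stepPotential, firstIndex_one]
    simp [cyclePotential]
  · rw [treePotential, if_neg h20, stepPotential, firstIndex_two]
    simp [cyclePotential]

/-- The anti-even-balancing labelling with the prescribed tree labels. -/
def treeLabelling : Labelling coC3 :=
  Labelling.ofPairs coC3 (fun x y => wrap x y + treePotential p i x + treePotential p i y)
    (hasCycleSums_wrap.switch _).symm

theorem onPairs_treeLabelling {x y : CircVertex} (h : coC3.Adj x y) :
    (treeLabelling p i).onPairs x y = wrap x y + treePotential p i x + treePotential p i y :=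
  Labelling.onPairs_ofPairs _ h

theorem isAntiEvenBalancing_treeLabelling : (treeLabelling p i).IsAntiEvenBalancing :=
  Labelling.isAntiEvenBalancing_of_hasCycleSums noIndepTriple_coC3
    ((hasCycleSums_wrap.switch (treePotential p i)).congr (Labelling.onPairs_comm _)
      (onPairs_treeLabelling p i))

variable {p i} in
theorem _root_.HasTreeLabels.onPairs {σ : Labelling coC3} (h : HasTreeLabels i p σ)
    {x : CircVertex} (hx : x ≠ p 0) : σ.onPairs x (p (firstIndex p x)) = i x := by
  have hk := isFirstNeighbour_firstIndex p x
  rw [σ.onPairs_of_adj hk.1]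
  exact h x _ hk hx

theorem hasTreeLabels_treeLabelling : HasTreeLabels i p (treeLabelling p i) := by
  intro x k hk hx
  obtain rfl := IsFirstNeighbour.firstIndex_eq hk
  refine (Labelling.onPairs_of_adj _ hk.1).symm.trans ?_
  rw [onPairs_treeLabelling p i hk.1, treePotential_firstIndex,
    treePotential, if_neg hx, stepPotential]
  linear_combination (wrap x (p (firstIndex p x)) + cyclePotential p i (firstIndex p x)) *
    two_eq_zero_zmod_two

variable {p i} in
-- Adding the labellings turns `ε` into `1 + 1 = 0`, so the sum is a coboundary. It vanishes on the
-- tree, which makes its potential constant.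
theorem eq_of_hasTreeLabels {σ τ : Labelling coC3} (hσ : σ.IsAntiEvenBalancing)
    (hτ : τ.IsAntiEvenBalancing) (hσ' : HasTreeLabels i p σ) (hτ' : HasTreeLabels i p τ) :
    τ = σ := by
  have t := two_eq_zero_zmod_two
  obtain ⟨s, hs⟩ := HasCycleSums.exists_coboundary (hτ.hasCycleSums.add hσ.hasCycleSums)
    noIndepTriple_coC3
  have hpar : ∀ x, x ≠ p 0 → s x = s (p (firstIndex p x)) := by
    intro x hx
    have h := hs x _ (isFirstNeighbour_firstIndex p x).1
    rw [hτ'.onPairs hx, hσ'.onPairs hx] at h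
    linear_combination (i x - s (p (firstIndex p x))) * t - h
  have h1 : s (p 1) = s (p 0) := by
    have := hpar (p 1) (p.injective.ne (by decide))
    rwa [firstIndex_one] at this
  have h2 : s (p 2) = s (p 0) := by
    have := hpar (p 2) (p.injective.ne (by decide))
    rw [firstIndex_two] at this
    exact this.trans h1
  have hconst : ∀ x, s x = s (p 0) := by
    intro x
    by_cases hx : x = p 0
    · rw [hx]
    · rw [hpar x hx]
      rcases firstIndex_cases p x with e | e | e <;> rw [e] <;> assumption
  refine Labelling.ext_onPairs fun x y hxy => ?_
  have h := hs x y hxy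
  rw [hconst x, hconst y] at h
  linear_combination h + (s (p 0) - σ.onPairs x y) * t

/-- The positions at which the adjacencies to the vertices of the cycle change. -/
def breakpoints : Set ℝ :=
  ⋃ j : Fin 5, (fun r => (p j).pos + r) '' {0, 1, -1, 2, -2, 3 / 2, -(3 / 2)}

theorem finite_breakpoints : (breakpoints p).Finite :=
  Set.finite_iUnion fun _ => Set.Finite.image _ (by simp)

/-- The offset 0 excludes the cycle vertices themselves, the offsets `±1` and `±2` control adjacency
to them and hence the first index, and `±3/2` controls `wrap`. -/
theorem stepPotential_eq {x y : CircVertex}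
    (h : ∀ t ∈ breakpoints p, x.pos ≠ t ∧ y.pos ≠ t ∧ (x.pos < t ↔ y.pos < t)) :
    stepPotential p i x = stepPotential p i y := by
  have hb : ∀ (j : Fin 5) (r : ℝ), r ∈ ({0, 1, -1, 2, -2, 3 / 2, -(3 / 2)} : Set ℝ) →
      x.pos ≠ (p j).pos + r ∧ y.pos ≠ (p j).pos + r ∧
        (x.pos < (p j).pos + r ↔ y.pos < (p j).pos + r) := fun j r hr =>
    h _ (Set.mem_iUnion.2 ⟨j, r, hr, rfl⟩)
  have habs : ∀ (j : Fin 5) (r : ℝ), r ∈ ({0, 1, -1, 2, -2, 3 / 2, -(3 / 2)} : Set ℝ) →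
      -r ∈ ({0, 1, -1, 2, -2, 3 / 2, -(3 / 2)} : Set ℝ) →
      (|x.pos - (p j).pos| < r ↔ |y.pos - (p j).pos| < r) ∧
        (r < |x.pos - (p j).pos| ↔ r < |y.pos - (p j).pos|) := by
    intro j r hr hr'
    obtain ⟨a1, a2, a3⟩ := hb j r hr
    obtain ⟨b1, b2, b3⟩ := hb j (-r) hr'
    have key : |x.pos - (p j).pos| < r ↔ |y.pos - (p j).pos| < r := by
      have c : ∀ u : ℝ, u ≠ (p j).pos + -r →
          (|u - (p j).pos| < r ↔ (¬ u < (p j).pos + -r) ∧ u < (p j).pos + r) := by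
        intro u hu
        rw [abs_lt, not_lt]
        constructor
        · rintro ⟨h1, h2⟩
          constructor <;> linarith
        · rintro ⟨h1, h2⟩
          have := lt_of_le_of_ne h1 hu.symm
          constructor <;> linarith
      rw [c _ b1, c _ b2, a3, b3]
    have ne : ∀ u : ℝ, u ≠ (p j).pos + r → u ≠ (p j).pos + -r → |u - (p j).pos| ≠ r := by
      intro u h1 h2 h3
      rcases abs_cases (u - (p j).pos) with ⟨e, -⟩ | ⟨e, -⟩
      · exact h1 (by linarith)
      · exact h2 (by linarith)
    refine ⟨key, ?_⟩
    have n1 := (ne _ a1 b1).symm.le_iff_lt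
    have n2 := (ne _ a2 b2).symm.le_iff_lt
    rw [← n1, ← n2, ← not_lt, ← not_lt, key]
  have hadj : ∀ j, coC3.Adj x (p j) ↔ coC3.Adj y (p j) := by
    intro j
    have hx : x ≠ p j := by
      rintro rfl
      exact (hb j 0 (by simp)).1 (by simp)
    have hy : y ≠ p j := by
      rintro rfl
      exact (hb j 0 (by simp)).2.1 (by simp)
    rw [coC3_adj_iff, coC3_adj_iff, (habs j 1 (by simp) (by simp)).1,
      (habs j 2 (by simp) (by simp)).2]
    simp [hx, hy]
  have hidx : firstIndex p x = firstIndex p y := by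
    refine IsFirstNeighbour.firstIndex_eq ⟨(hadj _).2 (isFirstNeighbour_firstIndex p y).1, ?_⟩
    exact fun j hj e => (isFirstNeighbour_firstIndex p y).2 j hj ((hadj j).1 e)
  have hwrap : ∀ j, wrap x (p j) = wrap y (p j) := by
    intro j
    rw [wrap, wrap]
    simp only [(habs j (3 / 2) (by simp) (by simp)).2]
  rw [stepPotential, stepPotential, hidx, hwrap]

variable {i} in
/-- Both values of the potential occur in every arc. -/
theorem exists_treePotential_eq (hi : IsDensePartition i) {a b : ℝ} (hab : a < b)
    (ha : -(3 / 2) ≤ a) (hb : b ≤ 3 / 2) (s : ZMod 2) :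
    ∃ x : CircVertex, a < x.pos ∧ x.pos < b ∧ treePotential p i x = s := by
  obtain ⟨x, h1, h2, h3, h4⟩ := exists_add_eq_of_isDensePartition hi (finite_breakpoints p)
    (fun x y h => stepPotential_eq p i h) hab ha hb s
  refine ⟨x, h1, h2, ?_⟩
  have hx : x ≠ p 0 := by
    rintro rfl
    exact h3 _ (Set.mem_iUnion.2 ⟨0, 0, by simp, rfl⟩) (by simp)
  rw [treePotential, if_neg hx, h4]

end Tree

/-! ### The embedding -/

/-- A finite graph with a clique partition and a numbering along its arcs embeds into the
complement of `ℂ₃`, with any prescribed values of a function that takes both values in every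
arc. -/
theorem exists_embedding {V : Type*} [Finite V] {G : SimpleGraph V}
    {l : V → V → ZMod 2} {a : V → Fin 3} {s : V → ZMod 2} (ha : IsCliquePartition G l a s)
    {c : V → ℕ} (hc : Function.Injective c) (hc' : ∀ {x y}, Precedes G a x y → c x < c y)
    {g : CircVertex → ZMod 2}
    (hg : ∀ a b : ℝ, a < b → -(3 / 2) ≤ a → b ≤ 3 / 2 → ∀ s : ZMod 2,
      ∃ x : CircVertex, a < x.pos ∧ x.pos < b ∧ g x = s) :
    ∃ f : G ↪g coC3, ∀ x, g (f x) = s x ∧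
      ∀ y, G.Adj x y → wrap (f x) (f y) = wrapLabel (a x) (a y) := by
  obtain ⟨N, hN⟩ : ∃ N : ℕ, ∀ x, c x + 1 ≤ N + 1 := by
    obtain ⟨N, hN⟩ := (Set.finite_range c).bddAbove
    exact ⟨N, fun x => Nat.succ_le_succ (hN ⟨x, rfl⟩)⟩
  have hN0 : (0 : ℝ) < N + 1 := by positivity
  have hfrac : ∀ x, (c x : ℝ) / (N + 1) < (c x + 1) / (N + 1) ∧ 0 ≤ (c x : ℝ) / (N + 1) ∧
      ((c x : ℝ) + 1) / (N + 1) ≤ 1 := by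
    intro x
    refine ⟨div_lt_div_of_pos_right (by linarith) hN0, by positivity, ?_⟩
    rw [div_le_one hN0]
    exact_mod_cast hN x
  have hval : ∀ x, ((a x : ℕ) : ℝ) ≤ 2 := by
    intro x
    have := (a x).2
    exact_mod_cast (by omega : (a x : ℕ) ≤ 2)
  -- The arc of each class is divided into `N + 1` slots; `x` goes into slot `c x` of the arc of
  -- class `a x`, so its offset `u x` increases with `c`.
  have hpick : ∀ x, ∃ z : CircVertex, (a x : ℕ) + (c x : ℝ) / (N + 1) - 3 / 2 < z.pos ∧
      z.pos < (a x : ℕ) + ((c x : ℝ) + 1) / (N + 1) - 3 / 2 ∧ g z = s x := by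
    intro x
    obtain ⟨h1, h2, h3⟩ := hfrac x
    have h4 := hval x
    have h5 : (0 : ℝ) ≤ (a x : ℕ) := Nat.cast_nonneg _
    exact hg _ _ (by linarith) (by linarith) (by linarith) (s x)
  choose f hf1 hf2 hf3 using hpick
  obtain ⟨u, hu⟩ : ∃ u : V → ℝ, ∀ x, (f x).pos = (a x : ℕ) + u x - 3 / 2 :=
    ⟨fun x => (f x).pos - (a x : ℕ) + 3 / 2, fun x => by ring⟩
  have hu0 : ∀ x, 0 < u x := by
    intro x
    have := hf1 x
    rw [hu] at this
    linarith [(hfrac x).2.1]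
  have hu1 : ∀ x, u x < 1 := by
    intro x
    have := hf2 x
    rw [hu] at this
    linarith [(hfrac x).2.2]
  have hmono : ∀ {x y}, c x < c y → u x < u y := by
    intro x y h
    have h1 := hf2 x
    have h2 := hf1 y
    rw [hu] at h1 h2
    have h3 : ((c x : ℝ) + 1) / (N + 1) ≤ (c y : ℝ) / (N + 1) :=
      div_le_div_of_nonneg_right (by exact_mod_cast h) hN0.le
    linarith
  have hinj : Function.Injective f := by
    intro x y hxy
    by_contra hne
    have hp : (f x).pos = (f y).pos := by rw [hxy]
    rw [hu, hu] at hp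
    have hax : a x = a y := by
      have k1 : ((a x : ℕ) : ℝ) < ((a y : ℕ) : ℝ) + 1 := by linarith [hu0 x, hu1 y]
      have k2 : ((a y : ℕ) : ℝ) < ((a x : ℕ) : ℝ) + 1 := by linarith [hu0 y, hu1 x]
      have k1' : (a x : ℕ) < a y + 1 := by exact_mod_cast k1
      have k2' : (a y : ℕ) < a x + 1 := by exact_mod_cast k2
      exact Fin.ext (by omega)
    rw [hax] at hp
    rcases lt_or_gt_of_ne (hc.ne hne) with h | h
    · linarith [hmono h]
    · linarith [hmono h]
  have hle : ∀ x y, x ≠ y → a x ≤ a y → (coC3.Adj (f x) (f y) ↔ G.Adj x y) ∧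
      (G.Adj x y → wrap (f x) (f y) = wrapLabel (a x) (a y)) := by
    intro x y hxy hxa
    have hx0 := hu0 x
    have hx1 := hu1 x
    have hy0 := hu0 y
    have hy1 := hu1 y
    -- In one class the distance is below 1. One class apart it is `1 + u y - u x`, and from class 0
    -- to class 2 it is `2 + u y - u x`, so the order of the offsets decides adjacency; only in the
    -- last case does an edge cross the cut.
    have hcase : ∀ i j : Fin 3, i ≤ j → i = j ∨ (j = i + 1 ∧ (j : ℕ) = i + 1) ∨
        (i = 0 ∧ j = 2) := by decide
    rcases hcase _ _ hxa with e | ⟨e, e'⟩ | ⟨e, e'⟩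
    · have hadj := ha.clique x y hxy e
      have h := coC3_adj_of_near (hinj.ne hxy) (by rw [hu, hu, e]; linarith)
        (by rw [hu, hu, e]; linarith)
      refine ⟨iff_of_true h.1 hadj, fun _ => ?_⟩
      have : ∀ i, wrapLabel i i = 0 := by unfold wrapLabel; decide
      rw [h.2, e, this]
    · have e'' : ((a y : ℕ) : ℝ) = (a x : ℕ) + 1 := by exact_mod_cast e'
      by_cases hadj : G.Adj x y
      · have h1 := hmono (hc' (Or.inr ⟨e, hadj.symm⟩ : Precedes G a y x))
        have h := coC3_adj_of_near (hinj.ne hxy) (by rw [hu, hu, e'']; linarith)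
          (by rw [hu, hu, e'']; linarith)
        refine ⟨iff_of_true h.1 hadj, fun _ => ?_⟩
        have : ∀ i j : Fin 3, (j : ℕ) = i + 1 → wrapLabel i j = 0 := by
          unfold wrapLabel; decide
        rw [h.2, this _ _ e']
      · have h1 := hmono (hc' (Or.inl ⟨e, hadj⟩ : Precedes G a x y))
        have h := not_coC3_adj (x := f x) (y := f y) (by rw [hu, hu, e'']; linarith)
          (by rw [hu, hu, e'']; linarith)
        exact ⟨iff_of_false h hadj, fun k => absurd k hadj⟩
    · have e1 : a x = a y + 1 := by rw [e, e']; rfl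
      have e2 : ((a x : ℕ) : ℝ) = 0 := by rw [e]; simp
      have e3 : ((a y : ℕ) : ℝ) = 2 := by rw [e']; simp
      by_cases hadj : G.Adj x y
      · have h1 := hmono (hc' (Or.inr ⟨e1, hadj⟩ : Precedes G a x y))
        have h := coC3_adj_of_far (x := f x) (y := f y) (by rw [hu, hu, e2, e3]; linarith)
        refine ⟨iff_of_true h.1 hadj, fun _ => ?_⟩
        rw [h.2, e, e']
        rfl
      · have h1 := hmono (hc' (Or.inl ⟨e1, mt G.adj_symm hadj⟩ : Precedes G a y x))
        have h := not_coC3_adj (x := f x) (y := f y) (by rw [hu, hu, e2, e3]; linarith)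
          (by rw [hu, hu, e2, e3]; linarith)
        exact ⟨iff_of_false h hadj, fun k => absurd k hadj⟩
  have hwl : ∀ i j, wrapLabel i j = wrapLabel j i := by unfold wrapLabel; decide
  have hall : ∀ x y, x ≠ y → (coC3.Adj (f x) (f y) ↔ G.Adj x y) ∧
      (G.Adj x y → wrap (f x) (f y) = wrapLabel (a x) (a y)) := by
    intro x y hxy
    rcases le_total (a x) (a y) with h | h
    · exact hle x y hxy h
    · have := hle y x hxy.symm h
      rw [coC3.adj_comm, G.adj_comm, wrap_comm, hwl]
      exact this
  refine ⟨⟨⟨f, hinj⟩, fun {x y} => ?_⟩, fun x => ⟨hf3 x, fun y h => (hall x y h.ne).2 h⟩⟩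
  by_cases hxy : x = y
  · subst hxy
    exact iff_of_false (coC3.loopless.irrefl _) (G.loopless.irrefl _)
  · exact (hall x y hxy).1

end CircVertex

end

/-! ### The theorem -/

theorem theorem3 :
    (∃ i : CircVertex → ZMod 2, IsDensePartition i) ∧
    Nonempty (SimpleGraph.cycleGraph 5 ↪g coC3) ∧
    ∀ (i : CircVertex → ZMod 2) (p : SimpleGraph.cycleGraph 5 ↪g coC3), IsDensePartition i →
      (firstNeighbourTree p ≤ coC3 ∧ (firstNeighbourTree p).IsTree) ∧
      ∃ σ : Labelling coC3,
        (σ.IsAntiEvenBalancing ∧ HasTreeLabels i p σ) ∧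
        (∀ τ : Labelling coC3, τ.IsAntiEvenBalancing → HasTreeLabels i p τ → τ = σ) ∧
        ∀ (V : Type*) [Finite V] (G : SimpleGraph V), G.IndepSetFree 3 →
          ∀ σG : Labelling G, σG.IsAntiEvenBalancing →
            ∃ f : G ↪g coC3, σ.pullback f = σG := by
  refine ⟨⟨_, CircVertex.isDensePartition_denParity⟩,
    CircVertex.nonempty_cycleGraph_five_embedding, fun i p hi =>
    ⟨⟨CircVertex.firstNeighbourTree_le p, CircVertex.isTree_firstNeighbourTree p⟩,
      CircVertex.treeLabelling p i, ⟨CircVertex.isAntiEvenBalancing_treeLabelling p i,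
        CircVertex.hasTreeLabels_treeLabelling p i⟩, fun τ h1 h2 =>
        CircVertex.eq_of_hasTreeLabels (CircVertex.isAntiEvenBalancing_treeLabelling p i) h1
          (CircVertex.hasTreeLabels_treeLabelling p i) h2, ?_⟩⟩
  intro V _ G hG σG hσG
  have hG' := noIndepTriple_of_indepSetFree hG
  have hl := hσG.hasCycleSums
  obtain ⟨a, s, ha⟩ := hl.exists_isCliquePartition hG'
  obtain ⟨c, hc, hc'⟩ := ha.exists_numbering hl hG'
  obtain ⟨f, hf⟩ := CircVertex.exists_embedding ha hc hc'
    (fun _ _ h1 h2 h3 s => CircVertex.exists_treePotential_eq p hi h1 h2 h3 s)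
  -- Both labellings are switchings: `wrap` by the potential and `wrapLabel` by `s`. Along `f` the
  -- two terms match separately.
  refine ⟨f, Labelling.ext_onPairs fun x y hxy => ?_⟩
  rw [Labelling.onPairs_pullback _ f hxy,
    CircVertex.onPairs_treeLabelling p i (f.map_rel_iff.2 hxy), (hf x).1, (hf y).1,
    (hf x).2 y hxy, ha.label x y hxy]
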